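/- Let $S$ be a locally compact, complete, separable metric space with a Radon measure $\lambda$. For a relatively compact Borel set $\Lambda\subset S$ let $\mathcal P_\Lambda f=\mathbf 1_\Lambda f$ on $L^2(S,\lambda)=L^2(S,\lambda;\mathbb C)$. Let $\mathcal K$ be an orthogonal projection on $L^2(S,\lambda)$ that is locally trace class, i.e. $\mathcal M_\Lambda:=\mathcal P_\Lambda\mathcal K\mathcal P_\Lambda$ is of trace class for every relatively compact Borel set $\Lambda$. Let $K:S\times S\to\mathbb C$ be a (measurable) kernel of $\mathcal K$: for $\lambda$-almost every $x$ one has $K(x,\cdot)\in L^2(S,\lambda)$, and for every $f\in L^2(S,\lambda)$, $\mathcal Kf(x)=\int_S K(x,y)f(y)\,d\lambda(y)$ for $\lambda$-almost every $x$. Let $\mathbb P$ be a determinantal point process on $(S,\lambda)$ with correlation kernel $K$, that is, a probability measure on the space of configurations $\Xi$ (nonnegative-integer-valued Radon measures on $S$) that is simple and whose $n$-th correlation function with respect to $\lambda^{\otimes n}$ is $\det(K(x_i,x_j))_{i,j=1}^n$ for every $n$. Let $(\Lambda^{(n)})_{n\in\mathbb N}$ be an exhaustion of $S$: relatively compact Borel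 sets with $\Lambda^{(n)}\subset\Lambda^{(n+1)}$ and $\bigcup_n\Lambda^{(n)}=S$. Assume that $\mathbb P$ is hyperuniform along it: $\Xi(\Lambda)\in L^2(\mathbb P)$ for all relatively compact Borel sets $\Lambda$, $\mathbb E[\Xi(\Lambda^{(n)})]\to\infty$ and $\operatorname{var}(\Xi(\Lambda^{(n)}))/\mathbb E[\Xi(\Lambda^{(n)})]\to0$. For $\Lambda=\Lambda^{(n)}$ let $$\mathcal M_\Lambda f=\sum_{j\ge1}\mu_j^{(\Lambda)}\langle f,\Phi_j^{(\Lambda)}\rangle\,\Phi_j^{(\Lambda)},\qquad \mu_1^{(\Lambda)}\ge\mu_2^{(\Lambda)}\ge\dots\ge0,$$ be any spectral decomposition of $\mathcal M_\Lambda$ with $(\Phi_j^{(\Lambda)})_{j\ge1}$ orthonormal. Let $\mathcal K\mathcal P_\Lambda=\mathcal W_\Lambda\sqrt{\mathcal M_\Lambda}$ be the polar decomposition of $\mathcal K\mathcal P_\Lambda$ ($\mathcal W_\Lambda$ is the partial isometry that vanishes on $\ker\mathcal M_\Lambda$), and set $\Psi_j^{(\Lambda)}=\mathcal W_\Lambda\Phi_j^{(\Lambda)}$,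 $N_\Lambda=\lceil\operatorname{Tr}\mathcal M_\Lambda\rceil$ and $$\rho_\Lambda(x)=\sum_{j=1}^{N_\Lambda}|\Psi_j^{(\Lambda)}(x)|^2 .$$ Then $\rho_{\Lambda^{(n)}}$ and $x\mapsto K(x,x)\mathbf 1_{\Lambda^{(n)}}(x)$ belong to $L^1(S,\lambda)$ for every $n$, and $$\lim_{n\to\infty}\frac1{N_{\Lambda^{(n)}}}\int_S\bigl|\rho_{\Lambda^{(n)}}(x)-K(x,x)\mathbf 1_{\Lambda^{(n)}}(x)\bigr|\,d\lambda(x)=0 .$$ -/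

import Mathlib

open MeasureTheory ProbabilityTheory Filter Topology
open scoped ENNReal ComplexOrder

/-! ### Trace class operators and the polar decomposition on a Hilbert space -/

section HilbertSpace

variable {H : Type*} [NormedAddCommGroup H] [InnerProductSpace ℂ H] [CompleteSpace H]

/-- A bounded operator `T` is of trace class if `∑ i, ⟨|T| e_i, e_i⟩ < ∞` for an orthonormal basis
`e`, where `|T| = √(T* T)`.  The terms are nonnegative and the sum does not depend on the basis. -/
def IsTraceClass (T : H →L[ℂ] H) : Prop :=
  ∃ (w : Set H) (e : HilbertBasis w ℂ H),
    Summable fun i : w => (inner ℂ (e i) (CFC.abs T (e i))).re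

/-- The trace `∑ i, ⟨T e_i, e_i⟩` of a (trace class) operator, computed in some orthonormal basis;
for trace class operators the value does not depend on the basis. -/
noncomputable def opTrace (T : H →L[ℂ] H) : ℂ :=
  ∑' i : (exists_hilbertBasis ℂ H).choose,
    inner ℂ ((exists_hilbertBasis ℂ H).choose_spec.choose i)
      (T ((exists_hilbertBasis ℂ H).choose_spec.choose i))

/-- The closure of the range of `|T| = √(T* T)`. -/
noncomputable abbrev absRangeClosure (T : H →L[ℂ] H) : Submodule ℂ H :=
  (LinearMap.range (CFC.abs T : H →L[ℂ] H).toLinearMap).topologicalClosure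

/-- The operator `|T|`, with codomain the closure of its range. -/
noncomputable def absToClosure (T : H →L[ℂ] H) : H →ₗ[ℂ] absRangeClosure T :=
  (CFC.abs T : H →L[ℂ] H).toLinearMap.codRestrict (absRangeClosure T)
    fun x => Submodule.le_topologicalClosure _ (LinearMap.mem_range_self _ x)

/-- The partial isometry `W` of the polar decomposition `T = W |T|`: the continuous extension of
`|T| f ↦ T f` to the closure of the range of `|T|`, and `0` on the orthogonal complement `ker T` of
that closure. -/
noncomputable def polarFactor (T : H →L[ℂ] H) : H →L[ℂ] H :=
  (T.toLinearMap.extendOfNorm (absToClosure T)).comp (absRangeClosure T).orthogonalProjectionOnto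

theorem norm_abs_apply (T : H →L[ℂ] H) (x : H) : ‖(CFC.abs T : H →L[ℂ] H) x‖ = ‖T x‖ := by
  have hsa : IsSelfAdjoint (CFC.abs T : H →L[ℂ] H) := (CFC.abs_nonneg T).isSelfAdjoint
  have h1 : inner ℂ ((CFC.abs T : H →L[ℂ] H) x) ((CFC.abs T : H →L[ℂ] H) x)
      = inner ℂ (T x) (T x) := by
    rw [← ContinuousLinearMap.adjoint_inner_right, ← ContinuousLinearMap.star_eq_adjoint,
      hsa.star_eq, ← mul_apply_eq_comp, CFC.abs_mul_abs,
      mul_apply_eq_comp, ContinuousLinearMap.star_eq_adjoint,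
      ContinuousLinearMap.adjoint_inner_right]
  rw [inner_self_eq_norm_sq_to_K, inner_self_eq_norm_sq_to_K] at h1
  have h2 : ‖(CFC.abs T : H →L[ℂ] H) x‖ ^ 2 = ‖T x‖ ^ 2 := by exact_mod_cast h1
  exact (pow_left_inj₀ (norm_nonneg _) (norm_nonneg _) two_ne_zero).1 h2

/-- `T = W |T|`. -/
theorem polarFactor_abs_apply (T : H →L[ℂ] H) (x : H) :
    polarFactor T ((CFC.abs T : H →L[ℂ] H) x) = T x := by
  have hd : DenseRange (absToClosure T) := by
    intro y
    rw [Metric.mem_closure_iff]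
    intro ε hε
    have hy : (y : H) ∈ closure (LinearMap.range (CFC.abs T : H →L[ℂ] H).toLinearMap : Set H) := by
      have := y.2
      rwa [← SetLike.mem_coe, Submodule.topologicalClosure_coe] at this
    obtain ⟨_, ⟨z, rfl⟩, hz⟩ := Metric.mem_closure_iff.1 hy ε hε
    exact ⟨absToClosure T z, ⟨z, rfl⟩, hz⟩
  have hm : (absRangeClosure T).orthogonalProjectionOnto ((CFC.abs T : H →L[ℂ] H) x)
      = absToClosure T x :=
    Submodule.orthogonalProjectionOnto_mem_subspace_eq_self (absToClosure T x)
  rw [polarFactor, ContinuousLinearMap.comp_apply, hm,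
    LinearMap.extendOfNorm_eq hd ⟨1, fun z => ?_⟩]
  · rfl
  · rw [one_mul]; exact (norm_abs_apply T z).symm.le

/-- `W` vanishes on `ker T`. -/
theorem polarFactor_eq_zero (T : H →L[ℂ] H) (x : H) (hx : T x = 0) : polarFactor T x = 0 := by
  have hsa : IsSelfAdjoint (CFC.abs T : H →L[ℂ] H) := (CFC.abs_nonneg T).isSelfAdjoint
  have h0 : (CFC.abs T : H →L[ℂ] H) x = 0 := by
    rw [← norm_eq_zero, norm_abs_apply, hx, norm_zero]
  have hmem : x ∈ (absRangeClosure T)ᗮ := by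
    rw [Submodule.orthogonal_closure, Submodule.mem_orthogonal]
    rintro _ ⟨z, rfl⟩
    change inner ℂ ((CFC.abs T : H →L[ℂ] H) z) x = 0
    rw [← ContinuousLinearMap.adjoint_inner_right, ← ContinuousLinearMap.star_eq_adjoint,
      hsa.star_eq, h0, inner_zero_right]
  rw [polarFactor, ContinuousLinearMap.comp_apply,
    Submodule.orthogonalProjectionOnto_apply_of_mem_orthogonal hmem, map_zero]

/-- A spectral decomposition `M f = ∑ j, μ_j ⟨f, Φ_j⟩ Φ_j` of a positive compact operator `M`: the
vectors `Φ_j` are orthonormal and the eigenvalues `μ_j ≥ 0` are listed in non-increasing order,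
with multiplicity.  All nonzero eigenvalues occur.  (If there are infinitely many of them, the
`Φ_j` span the orthogonal complement of `ker M`, since then a non-increasing sequence cannot
contain the eigenvalue `0`.) -/
structure IsSpectralDecomposition (M : H →L[ℂ] H) (μ : ℕ → ℝ) (Φ : ℕ → H) : Prop where
  antitone : Antitone μ
  nonneg : ∀ j, 0 ≤ μ j
  orthonormal : Orthonormal ℂ Φ
  hasSum : ∀ f : H, HasSum (fun j => ((μ j : ℂ) * inner ℂ (Φ j) f) • Φ j) (M f)

end HilbertSpace

/-! ### Locally trace class operators on `L²` and accumulated spectrograms -/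

section L2

variable {S : Type*} [MeasurableSpace S] {lam : Measure S}

/-- The restriction operator `f ↦ 1_Λ f` on `L²(S, lam)`. -/
noncomputable def restrictOp (lam : Measure S) {Λ : Set S} (hΛ : MeasurableSet Λ) :
    Lp ℂ 2 lam →L[ℂ] Lp ℂ 2 lam :=
  LinearMap.mkContinuous
    { toFun := fun f => ((Lp.memLp f).indicator hΛ).toLp (Λ.indicator f)
      map_add' := fun f g => by
        rw [← MemLp.toLp_add]
        refine MemLp.toLp_congr _ _ ?_
        filter_upwards [Lp.coeFn_add f g] with x hx
        by_cases h : x ∈ Λ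
        · simpa [h] using hx
        · simp [h]
      map_smul' := fun c f => by
        rw [RingHom.id_apply, ← MemLp.toLp_const_smul]
        refine MemLp.toLp_congr _ _ ?_
        filter_upwards [Lp.coeFn_smul c f] with x hx
        by_cases h : x ∈ Λ
        · simpa [h] using hx
        · simp [h] }
    1 fun f => by
      rw [one_mul]
      refine Lp.norm_le_norm_of_ae_le ?_
      filter_upwards [((Lp.memLp f).indicator hΛ).coeFn_toLp] with x hx
      change ‖(((Lp.memLp f).indicator hΛ).toLp (Λ.indicator f) : Lp ℂ 2 lam) x‖ ≤ _
      rw [hx]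
      exact norm_indicator_le_norm_self _ _

theorem restrictOp_coeFn {Λ : Set S} (hΛ : MeasurableSet Λ) (f : Lp ℂ 2 lam) :
    restrictOp lam hΛ f =ᵐ[lam] Λ.indicator f :=
  ((Lp.memLp f).indicator hΛ).coeFn_toLp

/-- `M_Λ = P_Λ 𝒦 P_Λ`. -/
noncomputable def opM (𝒦 : Lp ℂ 2 lam →L[ℂ] Lp ℂ 2 lam) {Λ : Set S} (hΛ : MeasurableSet Λ) :
    Lp ℂ 2 lam →L[ℂ] Lp ℂ 2 lam :=
  restrictOp lam hΛ ∘L 𝒦 ∘L restrictOp lam hΛ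

/-- `N_Λ = 𝒦 P_Λ`. -/
noncomputable def opN (𝒦 : Lp ℂ 2 lam →L[ℂ] Lp ℂ 2 lam) {Λ : Set S} (hΛ : MeasurableSet Λ) :
    Lp ℂ 2 lam →L[ℂ] Lp ℂ 2 lam :=
  𝒦 ∘L restrictOp lam hΛ

/-- The operator `𝒦` on `L²(S, lam)` is locally of trace class: `P_Λ 𝒦 P_Λ` is of trace class for
all relatively compact Borel sets `Λ`. -/
def IsLocallyTraceClass [TopologicalSpace S] (𝒦 : Lp ℂ 2 lam →L[ℂ] Lp ℂ 2 lam) : Prop :=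
  ∀ (Λ : Set S) (hΛ : MeasurableSet Λ), IsCompact (closure Λ) → IsTraceClass (opM 𝒦 hΛ)

/-- `K` is an integral kernel of the operator `𝒦`: for all `f`,
`(𝒦 f)(x) = ∫ K(x, y) f(y) dlam(y)` for almost all `x`.  The condition that `K(x, ·)` is in `L²`
for almost all `x` says that these integrals make sense for all `f ∈ L²`. -/
structure IsKernelOf (K : S → S → ℂ) (𝒦 : Lp ℂ 2 lam →L[ℂ] Lp ℂ 2 lam) : Prop where
  measurable : Measurable (Function.uncurry K)
  memLp : ∀ᵐ x ∂lam, MemLp (K x) 2 lam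
  apply_ae : ∀ f : Lp ℂ 2 lam, ∀ᵐ x ∂lam, 𝒦 f x = ∫ y, K x y * f y ∂lam

/-- The number `⌈Tr (P_Λ 𝒦 P_Λ)⌉`. -/
noncomputable def ceilTrace (𝒦 : Lp ℂ 2 lam →L[ℂ] Lp ℂ 2 lam) {Λ : Set S}
    (hΛ : MeasurableSet Λ) : ℕ :=
  ⌈(opTrace (opM 𝒦 hΛ)).re⌉₊

/-- The accumulated spectrogram `∑_{j ≤ ⌈Tr M_Λ⌉} |Ψ_j|²`, where `Ψ_j = W_Λ Φ_j`, the operator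
`W_Λ` is the partial isometry of the polar decomposition of `𝒦 P_Λ`, and `Φ` is the sequence of
eigenvectors of `M_Λ` in use.  (The sequence is indexed from `0`.) -/
noncomputable def accumulatedSpectrogram (𝒦 : Lp ℂ 2 lam →L[ℂ] Lp ℂ 2 lam) {Λ : Set S}
    (hΛ : MeasurableSet Λ) (Φ : ℕ → Lp ℂ 2 lam) (x : S) : ℝ :=
  ∑ j ∈ Finset.range (ceilTrace 𝒦 hΛ), ‖polarFactor (opN 𝒦 hΛ) (Φ j) x‖ ^ 2

end L2

/-! ### Point processes -/

section PointProcess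

variable {S : Type*} [TopologicalSpace S] [MeasurableSpace S]

/-- An exhaustion of `S`. -/
structure IsExhaustion (Λ : ℕ → Set S) : Prop where
  measurableSet : ∀ n, MeasurableSet (Λ n)
  isCompact_closure : ∀ n, IsCompact (closure (Λ n))
  subset_succ : ∀ n, Λ n ⊆ Λ (n + 1)
  iUnion_eq : ⋃ n, Λ n = Set.univ

/-- A configuration on `S` is a Radon measure with values in the nonnegative integers (and `∞` on
sets that are not relatively compact).  On the locally compact separable metric spaces considered
here, a Borel measure is Radon as soon as it is finite on compact sets. -/
def Conf (S : Type*) [TopologicalSpace S] [MeasurableSpace S] : Type _ :=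
  {ξ : Measure S // (∀ C, IsCompact C → ξ C < ∞) ∧
    ∀ B, MeasurableSet B → ξ B = ∞ ∨ ∃ k : ℕ, ξ B = k}

/-- The sigma-algebra generated by the maps `ξ ↦ ξ B`, `B` a Borel set.  For a locally compact
separable metric space `S` it is the Borel sigma-algebra of the vague topology. -/
instance : MeasurableSpace (Conf S) := inferInstanceAs (MeasurableSpace (Subtype _))

/-- The number `ξ B` of points of the configuration `ξ` in `B`. -/
noncomputable def countIn (B : Set S) (ξ : Conf S) : ℝ := (ξ.1 B).toReal

/-- The set of points of a configuration, which is also its support as a measure. -/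
def Conf.points (ξ : Conf S) : Set S := {x | ξ.1 {x} ≠ 0}

/-- A point process `P` is simple if almost surely every point has multiplicity one. -/
def IsSimple (P : Measure (Conf S)) : Prop :=
  ∀ᵐ ξ ∂P, ∀ x : S, ξ.1 {x} = 0 ∨ ξ.1 {x} = 1

/-- `r` is the `n`-th correlation function of `P` with respect to `lam`: it is nonnegative almost
everywhere, and `E[∑* f(x_1, …, x_n)] = ∫ f r dlam^n` for all measurable compactly supported
`f ≥ 0`, where the sum runs over the `n`-tuples of pairwise distinct points of the
configuration. -/
def IsCorrelationFunction (P : Measure (Conf S)) (lam : Measure S) (n : ℕ)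
    (r : (Fin n → S) → ℂ) : Prop :=
  (∀ᵐ x ∂(Measure.pi fun _ : Fin n => lam), 0 ≤ r x) ∧
  ∀ f : (Fin n → S) → ℝ≥0∞, Measurable f → HasCompactSupport f →
    ∫⁻ ξ, (∑' x : Fin n ↪ ξ.points, f fun i => (x i : S)) ∂P
      = ∫⁻ x, f x * ENNReal.ofReal (r x).re ∂(Measure.pi fun _ : Fin n => lam)

/-- `P` is a determinantal point process on `(S, lam)` with correlation kernel `K`. -/
structure IsDeterminantal (P : Measure (Conf S)) (lam : Measure S) (K : S → S → ℂ) : Prop where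
  simple : IsSimple P
  correlation : ∀ n : ℕ, IsCorrelationFunction P lam n
    fun x => (Matrix.of fun i j : Fin n => K (x i) (x j)).det

/-- `P` is hyperuniform along the exhaustion `Λ`: the numbers of points in relatively compact Borel
sets are square integrable, `E[ξ(Λ n)] → ∞` and `var(ξ(Λ n)) / E[ξ(Λ n)] → 0`. -/
structure IsHyperuniform (P : Measure (Conf S)) (Λ : ℕ → Set S) : Prop where
  memLp : ∀ B : Set S, MeasurableSet B → IsCompact (closure B) → MemLp (countIn B) 2 P
  tendsto_mean : Tendsto (fun n => ∫ ξ, countIn (Λ n) ξ ∂P) atTop atTop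
  tendsto_variance :
    Tendsto (fun n => variance (countIn (Λ n)) P / ∫ ξ, countIn (Λ n) ξ ∂P) atTop (𝓝 0)

end PointProcess

/-!
Fix a relatively compact set `Λ`, write `M = P_Λ 𝒦 P_Λ`, `N = ⌈Tr M⌉`, and let `m` and `V` be the
mean and the variance of the number `ξ(Λ)` of points in `Λ`.  The theorem follows from two bounds at
this fixed scale: the `L¹`-distance of the accumulated spectrogram `ρ` from `K(x, x) 1_Λ(x)` is at
most `1 + 2 V`, and `N ≥ m - V` (`IsDeterminantal.integral_norm_accumulatedSpectrogram_sub_le`).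
Since `V = o(m)` by hyperuniformity, the normalized distance tends to zero.

The bounds come from the following facts.

* Since `(𝒦 P_Λ)* 𝒦 P_Λ = M`, the vector `Ψ_j = W_Λ Φ_j` has norm at most one, and
  `P_Λ Ψ_j = √μ_j Φ_j` (`restrictOp_polarFactor`).  So `∫ ρ ≤ N`, and on `Λ` the spectrogram is the
  partial sum `∑_{j < N} μ_j |Φ_j|²` with integral `∑_{j < N} μ_j`.
* Mercer's expansion `K(x, y) = ∑ μ_j Φ_j(x) conj (Φ_j(y))` holds almost everywhere on `Λ × Λ`
  (`ae_tendsto_sum_kernel`).  So `K` is Hermitian there, and `∫∫_{Λ²} |K|² ≤ ∑ μ_j²`.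
* The first two correlation functions give `m = ∫_Λ K(x, x)` and
  `V = m - ∫∫_{Λ²} K(x, y) K(y, x)`, hence `m - ∑ μ_j² ≤ V`
  (`IsDeterminantal.integral_countIn_sub_le_variance`).
* The diagonal of `S × S` may be a null set, so `𝒦` does not determine `K(x, x)`, and
  `∫_Λ K(x, x) = Tr M` may fail.  But the second correlation function is nonnegative, so
  `|K(x, y)|² ≤ K(x, x) K(y, y)` almost everywhere, and this forces
  `∑_{j < J} μ_j |Φ_j(x)|² ≤ K(x, x)` for almost every `x ∈ Λ`
  (`IsDeterminantal.ae_sum_eigenvalue_mul_norm_sq_le`).  Hence `Tr M ≤ m`.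

Since `ρ ≤ K(x, x)` on `Λ`, the `L¹`-distance is `∫ ρ - 2 ∫_Λ ρ + m`, which is at most
`N - 2 ∑_{j < N} μ_j + m`.  The elementary inequality `∑_{j ≥ N} μ_j ≤ ∑ μ_j - ∑ μ_j²`
(`tsum_tail_le_tsum_sub_tsum_sq`) and the bounds
`N ≤ Tr M + 1` and `Tr M ≤ m` show that this is at most `1 + 2 (m - ∑ μ_j²) ≤ 1 + 2 V`.
-/

/-! ### The tail of the eigenvalue sequence -/

section Sequences

/-- If `μ` has total mass at most `N`, then `∑_{j < N} (1 - μ_j) ≥ ∑_{j ≥ N} μ_j`.  In the sum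
`∑ μ_j (1 - μ_j)`, the terms below `N` are at least `μ_N (1 - μ_j)`, and the others are at least
`(1 - μ_N) μ_j`, so the two parts add up to at least the tail. -/
theorem tsum_tail_le_tsum_sub_tsum_sq {μ : ℕ → ℝ} (hanti : Antitone μ) (h0 : ∀ j, 0 ≤ μ j)
    (h1 : ∀ j, μ j ≤ 1) (hs : Summable μ) {N : ℕ} (hN : ∑' j, μ j ≤ N) :
    ∑' j, μ (j + N) ≤ ∑' j, μ j - ∑' j, μ j ^ 2 := by
  have hsq : Summable fun j => μ j ^ 2 :=
    hs.of_nonneg_of_le (fun j => sq_nonneg _) fun j => by nlinarith [h0 j, h1 j]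
  have hd : Summable fun j => μ j - μ j ^ 2 := hs.sub hsq
  have e1 := hs.sum_add_tsum_nat_add N
  have e2 := hd.sum_add_tsum_nat_add N
  rw [hs.tsum_sub hsq] at e2
  have hhead : μ N * (N - ∑ j ∈ Finset.range N, μ j)
      ≤ ∑ j ∈ Finset.range N, (μ j - μ j ^ 2) := by
    have : μ N * (N - ∑ j ∈ Finset.range N, μ j) = ∑ j ∈ Finset.range N, μ N * (1 - μ j) := by
      simp [← Finset.mul_sum]
    rw [this]
    refine Finset.sum_le_sum fun j hj => ?_
    nlinarith [hanti (Finset.mem_range.1 hj).le, h1 j]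
  have htail : (1 - μ N) * ∑' j, μ (j + N) ≤ ∑' j, (μ (j + N) - μ (j + N) ^ 2) := by
    rw [← tsum_mul_left]
    refine Summable.tsum_le_tsum (fun j => ?_) (((summable_nat_add_iff N).2 hs).mul_left _)
      ((summable_nat_add_iff N).2 hd)
    nlinarith [hanti (Nat.le_add_left N j), h0 (j + N)]
  nlinarith [h0 N]

end Sequences

/-! ### Spectral decompositions, traces and polar decompositions -/

section HilbertSpace

variable {H : Type*} [NormedAddCommGroup H] [InnerProductSpace ℂ H]

/-- Distinct vectors of an orthonormal family have distance `√2`. -/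
theorem Orthonormal.countable_index [TopologicalSpace.SeparableSpace H] {ι : Type*} {v : ι → H}
    (hv : Orthonormal ℂ v) : Countable ι := by
  have hdist : ∀ i j, i ≠ j → 1 ≤ dist (v i) (v j) := by
    intro i j hij
    have h2 := norm_sub_sq (𝕜 := ℂ) (v i) (v j)
    rw [hv.2 hij, hv.1, hv.1] at h2
    simp only [map_zero, mul_zero, sub_zero, one_pow] at h2
    rw [dist_eq_norm]
    nlinarith [norm_nonneg (v i - v j)]
  have hc : (Set.univ : Set ι).Countable := by
    refine Set.PairwiseDisjoint.countable_of_isOpen (s := fun i => Metric.ball (v i) (1 / 2))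
      (fun i _ j _ hij => ?_) (fun i _ => Metric.isOpen_ball) fun i _ => ?_
    · refine Metric.ball_disjoint_ball ?_
      have := hdist i j hij
      linarith
    · exact ⟨v i, Metric.mem_ball_self (by norm_num)⟩
  exact Set.countable_univ_iff.1 hc

namespace IsSpectralDecomposition

variable {M : H →L[ℂ] H} {μ : ℕ → ℝ} {Φ : ℕ → H}

theorem apply_eigenvector (h : IsSpectralDecomposition M μ Φ) (j : ℕ) :
    M (Φ j) = (μ j : ℂ) • Φ j := by
  have h1 := hasSum_single (f := fun i => ((μ i : ℂ) * inner ℂ (Φ i) (Φ j)) • Φ i) j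
    fun i hi => by simp [h.orthonormal.2 hi]
  have h2 := (h.hasSum (Φ j)).unique h1
  rw [h2, inner_self_eq_norm_sq_to_K, h.orthonormal.1]
  simp

theorem hasSum_inner (h : IsSpectralDecomposition M μ Φ) (f : H) :
    HasSum (fun j => μ j * ‖inner ℂ (Φ j) f‖ ^ 2) (inner ℂ f (M f)).re := by
  have h1 := Complex.hasSum_re ((innerSL ℂ f).hasSum (h.hasSum f))
  change HasSum _ (innerSL ℂ f (M f)).re
  convert h1 using 1
  funext j
  simp only [innerSL_apply_apply, inner_smul_right]
  rw [← inner_conj_symm f (Φ j), mul_assoc, Complex.mul_conj, Complex.normSq_eq_norm_sq,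
    ← Complex.ofReal_mul, Complex.ofReal_re]

/-- The trace of `M` in any orthonormal basis is the sum of the eigenvalues. -/
theorem tsum_ofReal_inner (h : IsSpectralDecomposition M μ Φ) {ι : Type*} (e : HilbertBasis ι ℂ H) :
    ∑' i, ENNReal.ofReal (inner ℂ (e i) (M (e i))).re = ∑' j, ENNReal.ofReal (μ j) := by
  have h1 : ∀ i, ENNReal.ofReal (inner ℂ (e i) (M (e i))).re
      = ∑' j, ENNReal.ofReal (μ j) * ENNReal.ofReal (‖inner ℂ (Φ j) (e i)‖ ^ 2) := by
    intro i
    rw [← (h.hasSum_inner (e i)).tsum_eq, ENNReal.ofReal_tsum_of_nonneg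
      (fun j => mul_nonneg (h.nonneg j) (sq_nonneg _)) (h.hasSum_inner (e i)).summable]
    exact tsum_congr fun j => ENNReal.ofReal_mul (h.nonneg j)
  simp_rw [h1]
  rw [ENNReal.tsum_comm]
  refine tsum_congr fun j => ?_
  rw [ENNReal.tsum_mul_left]
  have h2 : HasSum (fun i => ‖inner ℂ (Φ j) (e i)‖ ^ 2) 1 := by
    have := Complex.hasSum_re (e.hasSum_inner_mul_inner (Φ j) (Φ j))
    rw [inner_self_eq_norm_sq_to_K, h.orthonormal.1] at this
    convert this using 1
    · funext i
      rw [← inner_conj_symm (e i) (Φ j), Complex.mul_conj,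
        Complex.normSq_eq_norm_sq, Complex.ofReal_re]
    · simp
  rw [← ENNReal.ofReal_tsum_of_nonneg (fun i => sq_nonneg _) h2.summable, h2.tsum_eq]
  simp

theorem summable_of_isTraceClass [CompleteSpace H] (h : IsSpectralDecomposition M μ Φ)
    (hpos : M.IsPositive) (htr : IsTraceClass M) : Summable μ := by
  obtain ⟨w, e, he⟩ := htr
  rw [CFC.abs_of_nonneg M ((ContinuousLinearMap.nonneg_iff_isPositive M).2 hpos)] at he
  have h1 := h.tsum_ofReal_inner e
  have h2 := he.tsum_ofReal_ne_top
  rw [h1] at h2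
  have h3 := ENNReal.summable_toReal h2
  exact h3.congr fun j => (ENNReal.toReal_ofReal (h.nonneg j))

theorem re_opTrace [CompleteSpace H] (h : IsSpectralDecomposition M μ Φ) (hpos : M.IsPositive) :
    (opTrace M).re = ∑' j, μ j := by
  rw [opTrace]
  set e := (exists_hilbertBasis ℂ H).choose_spec.choose
  have hre : ∀ i, inner ℂ (e i) (M (e i)) = (((inner ℂ (e i) (M (e i))).re : ℝ) : ℂ) := fun i => by
    have := hpos.inner_nonneg_right (e i)
    exact Complex.ext rfl (Complex.le_def.1 this).2.symm
  have hnn : ∀ i, 0 ≤ (inner ℂ (e i) (M (e i))).re := fun i =>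
    (Complex.le_def.1 (hpos.inner_nonneg_right (e i))).1
  rw [tsum_congr hre, ← Complex.ofReal_tsum, Complex.ofReal_re]
  have h1 := congrArg ENNReal.toReal (h.tsum_ofReal_inner e)
  rw [ENNReal.tsum_toReal_eq (fun _ => ENNReal.ofReal_ne_top),
    ENNReal.tsum_toReal_eq (fun _ => ENNReal.ofReal_ne_top)] at h1
  simpa only [ENNReal.toReal_ofReal (hnn _), ENNReal.toReal_ofReal (h.nonneg _)] using h1

end IsSpectralDecomposition

variable [CompleteSpace H]

/-- On an eigenvector of `T* T`, the modulus `|T|` acts as the square root of the eigenvalue. -/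
theorem abs_apply_eigenvector (T : H →L[ℂ] H) {m : ℝ} (hm : 0 < m) {f : H}
    (hf : (star T * T) f = (m : ℂ) • f) :
    (CFC.abs T : H →L[ℂ] H) f = (Real.sqrt m : ℂ) • f := by
  set A : H →L[ℂ] H := CFC.abs T
  have hpos : A.IsPositive :=
    (ContinuousLinearMap.nonneg_iff_isPositive A).1 (CFC.abs_nonneg T)
  have hs : 0 < Real.sqrt m := Real.sqrt_pos.2 hm
  set v := A f - (Real.sqrt m : ℂ) • f
  have hAA : A (A f) = (m : ℂ) • f := by
    rw [← hf, ← CFC.abs_mul_abs, mul_apply_eq_comp]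
  -- `(|T| + √m) (|T| - √m) f = 0`, and `|T| + √m` is injective since `|T| ≥ 0`
  have hAv : A v = -((Real.sqrt m : ℂ) • v) := by
    simp only [v, map_sub, map_smul, hAA, smul_sub, smul_smul]
    rw [← Complex.ofReal_mul, Real.mul_self_sqrt hm.le]
    abel
  have h1 := (Complex.le_def.1 (hpos.inner_nonneg_right v)).1
  rw [hAv, inner_neg_right, inner_smul_right, inner_self_eq_norm_sq_to_K] at h1
  have h2 : 0 ≤ -(Real.sqrt m * ‖v‖ ^ 2) := by
    have h3 : -((Real.sqrt m : ℂ) * ((‖v‖ : ℝ) : ℂ) ^ 2) = ((-(Real.sqrt m * ‖v‖ ^ 2) : ℝ) : ℂ) := by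
      push_cast; ring
    have h4 : (0 : ℂ).re ≤ (-((Real.sqrt m : ℂ) * ((‖v‖ : ℝ) : ℂ) ^ 2)).re := h1
    rwa [h3, Complex.ofReal_re, Complex.zero_re] at h4
  have h5 : v = 0 := by
    by_contra hv
    have := norm_pos_iff.2 hv
    have : 0 < Real.sqrt m * ‖v‖ ^ 2 := by positivity
    linarith
  exact sub_eq_zero.1 h5

theorem norm_sq_apply_eigenvector (T : H →L[ℂ] H) {m : ℝ} {f : H}
    (hf : (star T * T) f = (m : ℂ) • f) : ‖T f‖ ^ 2 = m * ‖f‖ ^ 2 := by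
  have h1 : inner ℂ (T f) (T f) = inner ℂ f ((star T * T) f) := by
    rw [mul_apply_eq_comp, ContinuousLinearMap.star_eq_adjoint,
      ContinuousLinearMap.adjoint_inner_right]
  rw [hf, inner_smul_right, inner_self_eq_norm_sq_to_K, inner_self_eq_norm_sq_to_K] at h1
  have h2 : (((‖T f‖ ^ 2 : ℝ)) : ℂ) = ((m * ‖f‖ ^ 2 : ℝ) : ℂ) := by
    push_cast
    exact h1
  exact Complex.ofReal_injective h2

theorem sqrt_smul_polarFactor (T : H →L[ℂ] H) {m : ℝ} (hm : 0 < m) {f : H}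
    (hf : (star T * T) f = (m : ℂ) • f) :
    (Real.sqrt m : ℂ) • polarFactor T f = T f := by
  rw [← map_smul, ← abs_apply_eigenvector T hm hf, polarFactor_abs_apply]

theorem norm_polarFactor_eigenvector_le (T : H →L[ℂ] H) {m : ℝ} (hm : 0 ≤ m) {f : H}
    (hf : (star T * T) f = (m : ℂ) • f) : ‖polarFactor T f‖ ≤ ‖f‖ := by
  have hn := norm_sq_apply_eigenvector T hf
  rcases hm.eq_or_lt with rfl | hm
  · have : T f = 0 := by simpa using hn
    simp [polarFactor_eq_zero T f this]
  · have h1 := congrArg norm (sqrt_smul_polarFactor T hm hf)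
    rw [norm_smul, Complex.norm_real, Real.norm_of_nonneg (Real.sqrt_nonneg m)] at h1
    rw [← h1, mul_pow, Real.sq_sqrt hm.le] at hn
    exact (pow_left_inj₀ (norm_nonneg _) (norm_nonneg _) two_ne_zero).1
      (mul_left_cancel₀ hm.ne' hn) |>.le

end HilbertSpace

/-! ### Restriction operators and integral kernels on `L²` -/

section L2

variable {S : Type*} [MeasurableSpace S] {lam : Measure S}

theorem lintegral_enorm_sq_Lp (f : Lp ℂ 2 lam) :
    ∫⁻ x, ‖f x‖ₑ ^ 2 ∂lam = ENNReal.ofReal (‖f‖ ^ 2) := by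
  have h1 := eLpNorm_nnreal_pow_eq_lintegral (f := f) (μ := lam) (p := 2) two_ne_zero
  have h2 : ENNReal.ofReal (‖f‖ ^ 2) = eLpNorm f 2 lam ^ 2 := by
    rw [ENNReal.ofReal_pow (norm_nonneg _), Lp.norm_def, ENNReal.ofReal_toReal (Lp.eLpNorm_ne_top f)]
  rw [h2]
  have h3 : ∀ a : ℝ≥0∞, a ^ ((2 : NNReal) : ℝ) = a ^ 2 := fun a => by
    rw [← ENNReal.rpow_natCast]; norm_num
  simp only [h3] at h1
  exact h1.symm

theorem restrictOp_isSelfAdjoint {Λ : Set S} (hΛ : MeasurableSet Λ) :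
    star (restrictOp lam hΛ) = restrictOp lam hΛ := by
  rw [ContinuousLinearMap.star_eq_adjoint, eq_comm, ContinuousLinearMap.eq_adjoint_iff]
  intro f g
  rw [L2.inner_def, L2.inner_def]
  refine integral_congr_ae ?_
  filter_upwards [restrictOp_coeFn hΛ f, restrictOp_coeFn hΛ g] with x hf hg
  rw [hf, hg]
  by_cases hx : x ∈ Λ <;> simp [hx]

theorem norm_restrictOp_apply_le {Λ : Set S} (hΛ : MeasurableSet Λ) (f : Lp ℂ 2 lam) :
    ‖restrictOp lam hΛ f‖ ≤ ‖f‖ := by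
  refine Lp.norm_le_norm_of_ae_le ?_
  filter_upwards [restrictOp_coeFn hΛ f] with x hx
  rw [hx]
  exact norm_indicator_le_norm_self _ _

theorem star_opN_mul_opN {𝒦 : Lp ℂ 2 lam →L[ℂ] Lp ℂ 2 lam} (h𝒦 : IsStarProjection 𝒦) {Λ : Set S}
    (hΛ : MeasurableSet Λ) : star (opN 𝒦 hΛ) * opN 𝒦 hΛ = opM 𝒦 hΛ := by
  have h1 : opN 𝒦 hΛ = 𝒦 * restrictOp lam hΛ := rfl
  have h2 : opM 𝒦 hΛ = restrictOp lam hΛ * (𝒦 * restrictOp lam hΛ) := rfl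
  rw [h1, h2, star_mul, restrictOp_isSelfAdjoint, h𝒦.isSelfAdjoint.star_eq, mul_assoc,
    ← mul_assoc 𝒦 𝒦, h𝒦.isIdempotentElem.eq]

theorem opM_isPositive {𝒦 : Lp ℂ 2 lam →L[ℂ] Lp ℂ 2 lam} (h𝒦 : IsStarProjection 𝒦) {Λ : Set S}
    (hΛ : MeasurableSet Λ) : (opM 𝒦 hΛ).IsPositive := by
  rw [← ContinuousLinearMap.nonneg_iff_isPositive, ← star_opN_mul_opN h𝒦]
  exact star_mul_self_nonneg _

theorem opM_apply_ae {𝒦 : Lp ℂ 2 lam →L[ℂ] Lp ℂ 2 lam} {Λ : Set S} (hΛ : MeasurableSet Λ)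
    {K : S → S → ℂ} (hK : IsKernelOf K 𝒦) (f : Lp ℂ 2 lam) :
    ∀ᵐ x ∂lam.restrict Λ, opM 𝒦 hΛ f x = ∫ y in Λ, K x y * f y ∂lam := by
  rw [ae_restrict_iff' hΛ]
  filter_upwards [restrictOp_coeFn hΛ (𝒦 (restrictOp lam hΛ f)), hK.apply_ae (restrictOp lam hΛ f)]
    with x h1 h2 hx
  have h3 : opM 𝒦 hΛ f x = 𝒦 (restrictOp lam hΛ f) x := by
    change restrictOp lam hΛ (𝒦 (restrictOp lam hΛ f)) x = _
    rw [h1, Set.indicator_of_mem hx]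
  rw [h3, h2, ← integral_indicator hΛ]
  refine integral_congr_ae ?_
  filter_upwards [restrictOp_coeFn hΛ f] with y hy
  rw [hy]
  by_cases hy' : y ∈ Λ <;> simp [hy']

section Spectral

variable {𝒦 : Lp ℂ 2 lam →L[ℂ] Lp ℂ 2 lam} {Λ : Set S} {hΛ : MeasurableSet Λ}
  {μ : ℕ → ℝ} {Φ : ℕ → Lp ℂ 2 lam}

theorem norm_polarFactor_le_one (h𝒦 : IsStarProjection 𝒦)
    (h : IsSpectralDecomposition (opM 𝒦 hΛ) μ Φ) (j : ℕ) :
    ‖polarFactor (opN 𝒦 hΛ) (Φ j)‖ ≤ 1 := by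
  rw [← h.orthonormal.1 j]
  refine norm_polarFactor_eigenvector_le _ (h.nonneg j) ?_
  rw [star_opN_mul_opN h𝒦, h.apply_eigenvector]

/-- `P_Λ W_Λ Φ_j = √μ_j Φ_j`. -/
theorem restrictOp_polarFactor (h𝒦 : IsStarProjection 𝒦)
    (h : IsSpectralDecomposition (opM 𝒦 hΛ) μ Φ) (j : ℕ) :
    restrictOp lam hΛ (polarFactor (opN 𝒦 hΛ) (Φ j)) = (Real.sqrt (μ j) : ℂ) • Φ j := by
  have he : (star (opN 𝒦 hΛ) * opN 𝒦 hΛ) (Φ j) = (μ j : ℂ) • Φ j := by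
    rw [star_opN_mul_opN h𝒦, h.apply_eigenvector]
  rcases (h.nonneg j).eq_or_lt with h0 | h0
  · have hn := norm_sq_apply_eigenvector _ he
    rw [← h0, zero_mul] at hn
    have : opN 𝒦 hΛ (Φ j) = 0 := by simpa using hn
    rw [polarFactor_eq_zero _ _ this, ← h0]
    simp
  · have h1 := congrArg (restrictOp lam hΛ) (sqrt_smul_polarFactor _ h0 he)
    rw [map_smul] at h1
    have h2 : restrictOp lam hΛ (opN 𝒦 hΛ (Φ j)) = (μ j : ℂ) • Φ j := h.apply_eigenvector j
    have hs : (Real.sqrt (μ j) : ℂ) ≠ 0 := by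
      exact_mod_cast (Real.sqrt_pos.2 h0).ne'
    refine smul_right_injective _ hs ?_
    change (Real.sqrt (μ j) : ℂ) • _ = (Real.sqrt (μ j) : ℂ) • _
    rw [h1, h2, smul_smul, ← Complex.ofReal_mul, Real.mul_self_sqrt h0.le]

theorem eigenvalue_le_one (h𝒦 : IsStarProjection 𝒦)
    (h : IsSpectralDecomposition (opM 𝒦 hΛ) μ Φ) (j : ℕ) : μ j ≤ 1 := by
  have h1 := norm_restrictOp_apply_le hΛ (polarFactor (opN 𝒦 hΛ) (Φ j))
  rw [restrictOp_polarFactor h𝒦 h, norm_smul, h.orthonormal.1, mul_one, Complex.norm_real,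
    Real.norm_of_nonneg (Real.sqrt_nonneg _)] at h1
  have h2 := h1.trans (norm_polarFactor_le_one h𝒦 h j)
  rwa [Real.sqrt_le_one] at h2

theorem norm_sq_polarFactor_ae (h𝒦 : IsStarProjection 𝒦)
    (h : IsSpectralDecomposition (opM 𝒦 hΛ) μ Φ) (j : ℕ) :
    ∀ᵐ x ∂lam.restrict Λ, ‖polarFactor (opN 𝒦 hΛ) (Φ j) x‖ ^ 2 = μ j * ‖Φ j x‖ ^ 2 := by
  rw [ae_restrict_iff' hΛ]
  have h1 := restrictOp_coeFn hΛ (polarFactor (opN 𝒦 hΛ) (Φ j))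
  rw [restrictOp_polarFactor h𝒦 h] at h1
  filter_upwards [h1, Lp.coeFn_smul (Real.sqrt (μ j) : ℂ) (Φ j)] with x h2 h3 hx
  rw [Set.indicator_of_mem hx] at h2
  rw [← h2, h3, Pi.smul_apply, norm_smul, mul_pow, Complex.norm_real,
    Real.norm_of_nonneg (Real.sqrt_nonneg _), Real.sq_sqrt (h.nonneg j)]

/-- Almost every row of the kernel, conjugated and cut off to `Λ`, expands in the eigenvectors with
the coefficients `μ_j conj (Φ_j x)`.  This holds since these are its inner products with the
eigenvectors, and since the row is orthogonal to the kernel of `M_Λ`. -/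
theorem exists_kernel_row_hasSum [TopologicalSpace.SeparableSpace (Lp ℂ 2 lam)]
    {K : S → S → ℂ} (hK : IsKernelOf K 𝒦) (h : IsSpectralDecomposition (opM 𝒦 hΛ) μ Φ) :
    ∀ᵐ x ∂lam.restrict Λ, ∃ k : Lp ℂ 2 lam,
      k =ᵐ[lam] Λ.indicator (fun y => starRingEnd ℂ (K x y)) ∧
      HasSum (fun j => ((μ j : ℂ) * starRingEnd ℂ (Φ j x)) • Φ j) k ∧
      HasSum (fun j => μ j ^ 2 * ‖Φ j x‖ ^ 2) (‖k‖ ^ 2) := by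
  have hinj : Function.Injective Φ := h.orthonormal.linearIndependent.injective
  obtain ⟨w, b, hw, hb⟩ := h.orthonormal.toSubtypeRange.exists_hilbertBasis_extension
  have : Countable w := Orthonormal.countable_index b.orthonormal
  let g : ℕ → w := fun j => ⟨Φ j, hw ⟨j, rfl⟩⟩
  have hg : Function.Injective g := fun i j hij => hinj (congrArg Subtype.val hij)
  have hbg : ∀ j, b (g j) = Φ j := fun j => by rw [hb]
  have hM0 : ∀ i ∉ Set.range g, opM 𝒦 hΛ (b i) = 0 := by
    intro i hi
    have h1 : ∀ j, ((μ j : ℂ) * inner ℂ (Φ j) (b i)) • Φ j = 0 := fun j => by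
      rw [← hbg, b.orthonormal.2 (fun hij => hi ⟨j, hij⟩)]
      simp
    have h2 := h.hasSum (b i)
    simp only [h1] at h2
    exact h2.unique hasSum_zero
  have hall : ∀ᵐ x ∂lam.restrict Λ, ∀ i, opM 𝒦 hΛ (b i) x = ∫ y in Λ, K x y * b i y ∂lam :=
    ae_all_iff.2 fun i => opM_apply_ae hΛ hK (b i)
  have hz : ∀ᵐ x ∂lam.restrict Λ, ∀ i ∉ Set.range g, opM 𝒦 hΛ (b i) x = 0 := by
    refine ae_all_iff.2 fun i => ?_
    by_cases hi : i ∈ Set.range g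
    · exact Eventually.of_forall fun x hx => absurd hi hx
    · rw [hM0 i hi]
      filter_upwards [ae_restrict_of_ae (Lp.coeFn_zero ℂ 2 lam)] with x hx _
      simpa using hx
  have he : ∀ᵐ x ∂lam.restrict Λ, ∀ j, opM 𝒦 hΛ (Φ j) x = μ j * Φ j x := by
    refine ae_all_iff.2 fun j => ?_
    rw [h.apply_eigenvector]
    filter_upwards [ae_restrict_of_ae (Lp.coeFn_smul (μ j : ℂ) (Φ j))] with x hx
    simpa using hx
  filter_upwards [hall, hz, he, ae_restrict_of_ae hK.memLp] with x hx1 hx2 hx3 hx4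
  have hmem : MemLp (Λ.indicator fun y => starRingEnd ℂ (K x y)) 2 lam := by
    refine MemLp.indicator hΛ ?_
    exact hx4.star
  set k : Lp ℂ 2 lam := hmem.toLp _
  have hk : k =ᵐ[lam] Λ.indicator fun y => starRingEnd ℂ (K x y) := hmem.coeFn_toLp
  have hinner : ∀ i, inner ℂ k (b i) = opM 𝒦 hΛ (b i) x := by
    intro i
    rw [hx1, L2.inner_def, ← integral_indicator hΛ]
    refine integral_congr_ae ?_
    filter_upwards [hk] with y hy
    rw [hy]
    by_cases hy' : y ∈ Λ <;> simp [hy', mul_comm]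
  have hcoef : ∀ j, inner ℂ (Φ j) k = (μ j : ℂ) * starRingEnd ℂ (Φ j x) := by
    intro j
    have := hinner (g j)
    rw [hbg, hx3] at this
    rw [← inner_conj_symm, this, map_mul, Complex.conj_ofReal]
  have hsum : HasSum (fun j => ((μ j : ℂ) * starRingEnd ℂ (Φ j x)) • Φ j) k := by
    have h1 := b.hasSum_repr k
    rw [← hg.hasSum_iff] at h1
    · convert h1 using 1
      funext j
      rw [Function.comp, b.repr_apply_apply, hbg, hcoef]
    · intro i hi
      rw [b.repr_apply_apply, ← inner_conj_symm, hinner, hx2 i hi]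
      simp
  refine ⟨k, hk, hsum, ?_⟩
  have h1 := Complex.hasSum_re ((innerSL ℂ k).hasSum hsum)
  have h2 : ((innerSL ℂ k) k).re = ‖k‖ ^ 2 := by
    rw [innerSL_apply_apply]
    exact (norm_sq_eq_re_inner (𝕜 := ℂ) k).symm
  rw [h2] at h1
  convert h1 using 1
  funext j
  rw [innerSL_apply_apply, inner_smul_right, ← inner_conj_symm k, hcoef, map_mul, Complex.conj_conj,
    Complex.conj_ofReal]
  have : (μ j : ℂ) * starRingEnd ℂ (Φ j x) * ((μ j : ℂ) * Φ j x)
      = ((μ j ^ 2 * ‖Φ j x‖ ^ 2 : ℝ) : ℂ) := by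
    push_cast
    rw [← Complex.mul_conj']
    ring
  rw [this, Complex.ofReal_re]

/-- The Hilbert–Schmidt norm of the kernel on `Λ × Λ` is at most that of `M_Λ`. -/
theorem lintegral_lintegral_enorm_sq_kernel_le [TopologicalSpace.SeparableSpace (Lp ℂ 2 lam)]
    {K : S → S → ℂ} (hK : IsKernelOf K 𝒦) (h : IsSpectralDecomposition (opM 𝒦 hΛ) μ Φ)
    (hs : Summable fun j => μ j ^ 2) :
    ∫⁻ x in Λ, ∫⁻ y in Λ, ‖K x y‖ₑ ^ 2 ∂lam ∂lam ≤ ENNReal.ofReal (∑' j, μ j ^ 2) := by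
  have h1 : ∀ᵐ x ∂lam.restrict Λ, ∫⁻ y in Λ, ‖K x y‖ₑ ^ 2 ∂lam
      = ∑' j, ENNReal.ofReal (μ j ^ 2) * ‖Φ j x‖ₑ ^ 2 := by
    filter_upwards [exists_kernel_row_hasSum hK h] with x hx
    obtain ⟨k, hk, -, hk2⟩ := hx
    have h2 : ∫⁻ y in Λ, ‖K x y‖ₑ ^ 2 ∂lam = ∫⁻ y, ‖k y‖ₑ ^ 2 ∂lam := by
      rw [← lintegral_indicator hΛ]
      refine lintegral_congr_ae ?_
      filter_upwards [hk] with y hy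
      rw [hy]
      by_cases hy' : y ∈ Λ <;> simp [hy']
    rw [h2, lintegral_enorm_sq_Lp, ← hk2.tsum_eq, ENNReal.ofReal_tsum_of_nonneg
      (fun j => by positivity) hk2.summable]
    refine tsum_congr fun j => ?_
    rw [ENNReal.ofReal_mul (sq_nonneg _), ENNReal.ofReal_pow (norm_nonneg _), ofReal_norm]
  rw [lintegral_congr_ae h1, lintegral_tsum fun j =>
    (((Lp.stronglyMeasurable (Φ j)).measurable.enorm.pow_const 2).const_mul _).aemeasurable,
    ENNReal.ofReal_tsum_of_nonneg (fun j => sq_nonneg _) hs]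
  refine ENNReal.tsum_le_tsum fun j => ?_
  rw [lintegral_const_mul _ ((Lp.stronglyMeasurable (Φ j)).measurable.enorm.pow_const 2)]
  calc _ ≤ ENNReal.ofReal (μ j ^ 2) * ∫⁻ x, ‖Φ j x‖ₑ ^ 2 ∂lam := by
        gcongr; exact Measure.restrict_le_self
    _ = _ := by rw [lintegral_enorm_sq_Lp, h.orthonormal.1]; simp

theorem ae_summable_eigenvalue_mul_norm_sq (h : IsSpectralDecomposition (opM 𝒦 hΛ) μ Φ)
    (hs : Summable μ) : ∀ᵐ x ∂lam, Summable fun j => μ j * ‖Φ j x‖ ^ 2 := by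
  have hm : ∀ j, Measurable fun x => ENNReal.ofReal (μ j) * ‖Φ j x‖ₑ ^ 2 := fun j =>
    ((Lp.stronglyMeasurable (Φ j)).measurable.enorm.pow_const 2).const_mul _
  have h1 : ∫⁻ x, ∑' j, ENNReal.ofReal (μ j) * ‖Φ j x‖ₑ ^ 2 ∂lam ≠ ∞ := by
    rw [lintegral_tsum fun j => (hm j).aemeasurable]
    have : ∀ j, ∫⁻ x, ENNReal.ofReal (μ j) * ‖Φ j x‖ₑ ^ 2 ∂lam = ENNReal.ofReal (μ j) := fun j => by
      rw [lintegral_const_mul _ ((Lp.stronglyMeasurable (Φ j)).measurable.enorm.pow_const 2),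
        lintegral_enorm_sq_Lp, h.orthonormal.1]
      simp
    simp_rw [this]
    exact hs.tsum_ofReal_ne_top
  filter_upwards [ae_lt_top (Measurable.tsum hm) h1] with x hx
  refine (ENNReal.summable_toReal hx.ne).congr fun j => ?_
  rw [ENNReal.toReal_mul, ENNReal.toReal_ofReal (h.nonneg j), ENNReal.toReal_pow, toReal_enorm]

/-- Mercer's expansion of the kernel, almost everywhere on `Λ × Λ`. -/
theorem ae_tendsto_sum_kernel [SFinite lam] [TopologicalSpace.SeparableSpace (Lp ℂ 2 lam)]
    {K : S → S → ℂ} (hK : IsKernelOf K 𝒦) (h : IsSpectralDecomposition (opM 𝒦 hΛ) μ Φ)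
    (hs : Summable μ) :
    ∀ᵐ z ∂(lam.restrict Λ).prod (lam.restrict Λ),
      Tendsto (fun J => ∑ j ∈ Finset.range J, (μ j : ℂ) * (Φ j z.1 * starRingEnd ℂ (Φ j z.2)))
        atTop (𝓝 (K z.1 z.2)) := by
  have hm : ∀ j, Measurable (Φ j) := fun j => (Lp.stronglyMeasurable (Φ j)).measurable
  refine (Measure.ae_prod_iff_ae_ae (measurableSet_tendsto_fun (fun J =>
    Finset.measurable_fun_sum _ fun j _ => measurable_const.mul
      (((hm j).comp measurable_fst).mul (Complex.continuous_conj.measurable.comp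
        ((hm j).comp measurable_snd)))) hK.measurable)).2 ?_
  have hsq := ae_restrict_of_ae (s := Λ) (ae_summable_eigenvalue_mul_norm_sq h hs)
  filter_upwards [exists_kernel_row_hasSum hK h, hsq] with x hx hxs
  obtain ⟨k, hk, hk2, -⟩ := hx
  obtain ⟨ns, hns, hlim⟩ :=
    (tendstoInMeasure_of_tendsto_Lp hk2.tendsto_sum_nat).exists_seq_tendsto_ae
  have hpart : ∀ᵐ y ∂lam, ∀ J, (∑ j ∈ Finset.range J,
      ((μ j : ℂ) * starRingEnd ℂ (Φ j x)) • Φ j : Lp ℂ 2 lam) y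
      = ∑ j ∈ Finset.range J, (μ j : ℂ) * starRingEnd ℂ (Φ j x) * Φ j y := by
    have hsm : ∀ᵐ y ∂lam, ∀ j, (((μ j : ℂ) * starRingEnd ℂ (Φ j x)) • Φ j : Lp ℂ 2 lam) y
        = (μ j : ℂ) * starRingEnd ℂ (Φ j x) * Φ j y := by
      refine ae_all_iff.2 fun j => ?_
      filter_upwards [Lp.coeFn_smul ((μ j : ℂ) * starRingEnd ℂ (Φ j x)) (Φ j)] with y hy
      simpa using hy
    refine ae_all_iff.2 fun J => ?_
    filter_upwards [hsm, Lp.coeFn_fun_finsetSum (Finset.range J)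
      fun j => ((μ j : ℂ) * starRingEnd ℂ (Φ j x)) • Φ j] with y hy1 hy2
    rw [hy2]
    exact Finset.sum_congr rfl fun j _ => hy1 j
  filter_upwards [ae_restrict_of_ae hlim, ae_restrict_of_ae hpart, ae_restrict_of_ae hk, hsq,
    ae_restrict_mem hΛ] with y hy1 hy2 hy3 hys hyΛ
  have hsum : Summable fun j => (μ j : ℂ) * (Φ j x * starRingEnd ℂ (Φ j y)) := by
    refine Summable.of_norm_bounded (hxs.add hys) fun j => ?_
    rw [norm_mul, norm_mul, Complex.norm_real, Real.norm_of_nonneg (h.nonneg j), RCLike.norm_conj,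
      ← mul_add]
    refine mul_le_mul_of_nonneg_left ?_ (h.nonneg j)
    nlinarith [sq_nonneg (‖Φ j x‖ - ‖Φ j y‖), sq_nonneg (‖Φ j x‖), sq_nonneg (‖Φ j y‖)]
  have hT := hsum.hasSum.tendsto_sum_nat
  have hL := (Complex.continuous_conj.tendsto _).comp hy1
  rw [hy3, Set.indicator_of_mem hyΛ, Complex.conj_conj] at hL
  have heq : (starRingEnd ℂ) ∘ (fun i => (∑ j ∈ Finset.range (ns i),
      ((μ j : ℂ) * starRingEnd ℂ (Φ j x)) • Φ j : Lp ℂ 2 lam) y)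
      = (fun J => ∑ j ∈ Finset.range J, (μ j : ℂ) * (Φ j x * starRingEnd ℂ (Φ j y))) ∘ ns := by
    funext i
    simp only [Function.comp, hy2, map_sum, map_mul, Complex.conj_conj, Complex.conj_ofReal,
      mul_assoc]
  rw [heq] at hL
  change Tendsto (fun J => ∑ j ∈ Finset.range J, (μ j : ℂ) * (Φ j x * starRingEnd ℂ (Φ j y)))
    atTop (𝓝 (K x y))
  rw [tendsto_nhds_unique hL (hT.comp hns.tendsto_atTop)]
  exact hT

theorem ae_kernel_hermitian [SFinite lam] [TopologicalSpace.SeparableSpace (Lp ℂ 2 lam)]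
    {K : S → S → ℂ} (hK : IsKernelOf K 𝒦) (h : IsSpectralDecomposition (opM 𝒦 hΛ) μ Φ)
    (hs : Summable μ) :
    ∀ᵐ z ∂(lam.restrict Λ).prod (lam.restrict Λ), K z.2 z.1 = starRingEnd ℂ (K z.1 z.2) := by
  have h1 := ae_tendsto_sum_kernel hK h hs
  have h2 := (Measure.measurePreserving_swap (μ := lam.restrict Λ)
    (ν := lam.restrict Λ)).quasiMeasurePreserving.ae h1
  filter_upwards [h1, h2] with z hz1 hz2
  refine tendsto_nhds_unique hz2 ?_
  convert (Complex.continuous_conj.tendsto _).comp hz1 using 1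
  funext J
  simp [mul_comm]

end Spectral

end L2

/-! ### Counting the points of a simple point process -/

section PointProcess

variable {S : Type*} [MetricSpace S] [MeasurableSpace S]

/-- A finite integer-valued measure without atoms vanishes: every point has a neighbourhood of
measure less than one. -/
theorem measure_univ_eq_zero_of_natValued [SecondCountableTopology S] [BorelSpace S]
    (ν : Measure S) [IsFiniteMeasure ν]
    (hint : ∀ B, MeasurableSet B → ∃ k : ℕ, ν B = k) (hatom : ∀ x, ν {x} = 0) :
    ν Set.univ = 0 := by
  refine measure_null_of_locally_null _ fun x _ => ?_
  obtain ⟨U, hxU, hU, hlt⟩ := Set.exists_isOpen_lt_of_lt (μ := ν) {x} 1 (by rw [hatom]; simp)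
  refine ⟨U, mem_nhdsWithin_of_mem_nhds (hU.mem_nhds (hxU rfl)), ?_⟩
  obtain ⟨k, hk⟩ := hint U hU.measurableSet
  rw [hk] at hlt ⊢
  have : k < 1 := by exact_mod_cast hlt
  simp [Nat.lt_one_iff.1 this]

/-- In a set of finite mass, a simple configuration is the counting measure of its points. -/
theorem Conf.exists_finset_points [SecondCountableTopology S] [BorelSpace S]
    (ξ : Conf S) (hξ : ∀ x : S, ξ.1 {x} = 0 ∨ ξ.1 {x} = 1)
    {B : Set S} (hB : MeasurableSet B) (hfin : ξ.1 B < ∞) :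
    ∃ F : Finset S, (F : Set S) = ξ.points ∩ B ∧ ξ.1 B = F.card := by
  have hone : ∀ F : Finset S, (F : Set S) ⊆ ξ.points ∩ B → ξ.1 (F : Set S) = F.card := by
    intro F hF
    rw [← sum_measure_singleton]
    rw [Finset.sum_congr rfl fun x hx => (hξ x).resolve_left (hF hx).1]
    simp
  have hf : (ξ.points ∩ B).Finite := by
    by_contra hinf
    obtain ⟨k, hk⟩ := ENNReal.exists_nat_gt hfin.ne
    obtain ⟨F, hF, hc⟩ := Set.Infinite.exists_subset_card_eq hinf k
    have h1 := measure_mono (μ := ξ.1) (hF.trans Set.inter_subset_right)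
    rw [hone F hF, hc] at h1
    exact absurd hk h1.not_gt
  refine ⟨hf.toFinset, hf.coe_toFinset, ?_⟩
  have hA : MeasurableSet (ξ.points ∩ B) := hf.measurableSet
  have h0 : ξ.1 (B \ (ξ.points ∩ B)) = 0 := by
    have hm : MeasurableSet (B \ (ξ.points ∩ B)) := hB.diff hA
    have hlt : ∀ C, ξ.1 (C ∩ (B \ (ξ.points ∩ B))) < ∞ := fun C =>
      (measure_mono (Set.inter_subset_right.trans Set.sdiff_subset)).trans_lt hfin
    have : IsFiniteMeasure (ξ.1.restrict (B \ (ξ.points ∩ B))) :=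
      ⟨by rw [Measure.restrict_apply MeasurableSet.univ]; exact hlt _⟩
    have h1 := measure_univ_eq_zero_of_natValued (ξ.1.restrict (B \ (ξ.points ∩ B)))
      (fun C hC => by
        rw [Measure.restrict_apply hC]
        exact (ξ.2.2 _ (hC.inter hm)).resolve_left (hlt C).ne)
      (fun x => by
        rw [Measure.restrict_apply (measurableSet_singleton x)]
        by_cases hx : x ∈ B \ (ξ.points ∩ B)
        · have hx0 : ξ.1 {x} = 0 := by
            by_contra hne
            exact hx.2 ⟨hne, hx.1⟩
          exact measure_mono_null Set.inter_subset_left hx0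
        · have : {x} ∩ (B \ (ξ.points ∩ B)) = ∅ := by
            rw [Set.singleton_inter_eq_empty]; exact hx
          rw [this, measure_empty])
    rwa [Measure.restrict_apply MeasurableSet.univ, Set.univ_inter] at h1
  rw [← measure_sdiff_add_inter B hA, h0, zero_add, Set.inter_eq_right.2 Set.inter_subset_right,
    ← hone hf.toFinset (by rw [hf.coe_toFinset]), hf.coe_toFinset]

/-- The number of `k`-tuples of distinct points of a simple configuration in a set. -/
theorem Conf.tsum_embedding_indicator (ξ : Conf S) {B : Set S} {F : Finset S}
    (hF : (F : Set S) = ξ.points ∩ B) (k : ℕ) :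
    ∑' x : Fin k ↪ ξ.points, {x : Fin k → S | ∀ i, x i ∈ B}.indicator (1 : (Fin k → S) → ℝ≥0∞)
      (fun i => (x i : S)) = (F.card.descFactorial k : ℕ) := by
  let s : Set (Fin k ↪ ξ.points) := {x | ∀ i, (x i : S) ∈ B}
  have hmem : ∀ x : s, ∀ i, (x.1 i : S) ∈ F := fun x i => by
    rw [← Finset.mem_coe, hF]
    exact ⟨(x.1 i).2, x.2 i⟩
  have hmem' : ∀ y : F, (y : S) ∈ ξ.points ∩ B := fun y => by
    rw [← hF]; exact y.2
  let e : s ≃ (Fin k ↪ F) :=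
    { toFun := fun x => ⟨fun i => ⟨x.1 i, hmem x i⟩, fun i j hij =>
        x.1.injective (Subtype.ext (congrArg (fun y : F => (y : S)) hij))⟩
      invFun := fun y => ⟨⟨fun i => ⟨y i, (hmem' (y i)).1⟩, fun i j hij =>
        y.injective (Subtype.ext (congrArg (fun z : ξ.points => (z : S)) hij))⟩,
          fun i => (hmem' (y i)).2⟩
      left_inv := fun x => rfl
      right_inv := fun y => rfl }
  have h1 : ∀ x : Fin k ↪ ξ.points, {x : Fin k → S | ∀ i, x i ∈ B}.indicator
      (1 : (Fin k → S) → ℝ≥0∞) (fun i => (x i : S)) = s.indicator (fun _ => 1) x := fun x => rfl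
  rw [tsum_congr h1, ← tsum_subtype, ← e.symm.tsum_eq, tsum_fintype]
  simp [Fintype.card_embedding_eq]

variable {lam : Measure S} {K : S → S → ℂ} {P : Measure (Conf S)}

theorem IsDeterminantal.ae_diag_nonneg (hP : IsDeterminantal P lam K) : ∀ᵐ x ∂lam, 0 ≤ K x x := by
  have h1 := (hP.correlation 1).1
  have h2 := (measurePreserving_funUnique lam (Fin 1)).symm.quasiMeasurePreserving.ae h1
  filter_upwards [h2] with x hx
  simpa [Matrix.det_unique] using hx

theorem IsDeterminantal.ae_det_two_nonneg [SigmaFinite lam] (hP : IsDeterminantal P lam K) :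
    ∀ᵐ z ∂lam.prod lam, 0 ≤ K z.1 z.1 * K z.2 z.2 - K z.1 z.2 * K z.2 z.1 := by
  have h1 := (hP.correlation 2).1
  have h2 := (measurePreserving_finTwoArrow lam).symm.quasiMeasurePreserving.ae h1
  filter_upwards [h2] with x hx
  simpa [Matrix.det_fin_two] using hx

variable [SecondCountableTopology S] [BorelSpace S] [SigmaFinite lam]

/-- The factorial moments of the number of points in a relatively compact set. -/
theorem IsDeterminantal.lintegral_descFactorial (hP : IsDeterminantal P lam K) {B : Set S}
    (hB : MeasurableSet B) (hBc : IsCompact (closure B)) {N : Conf S → ℕ}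
    (hN : ∀ᵐ ξ ∂P, ξ.1 B = N ξ) (k : ℕ) :
    ∫⁻ ξ, ((N ξ).descFactorial k : ℕ) ∂P
      = ∫⁻ x, ENNReal.ofReal (Matrix.of fun i j : Fin k => K (x i) (x j)).det.re
          ∂(Measure.pi fun _ : Fin k => lam.restrict B) := by
  have hms : MeasurableSet {x : Fin k → S | ∀ i, x i ∈ B} :=
    MeasurableSet.univ_pi (fun _ => hB) |>.congr (by ext; simp)
  have hpi : {x : Fin k → S | ∀ i, x i ∈ B} = Set.univ.pi fun _ => B := by ext; simp
  have hcs : HasCompactSupport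
      ({x : Fin k → S | ∀ i, x i ∈ B}.indicator (1 : (Fin k → S) → ℝ≥0∞)) := by
    refine HasCompactSupport.intro (K := Set.univ.pi fun _ => closure B)
      (isCompact_univ_pi fun _ => hBc) fun x hx => ?_
    refine Set.indicator_of_notMem (fun hx' : ∀ i, x i ∈ B => hx fun i _ => subset_closure (hx' i)) _
  have h1 := (hP.correlation k).2 _ (measurable_one.indicator hms) hcs
  have h2 : ∫⁻ ξ, ((N ξ).descFactorial k : ℕ) ∂P = ∫⁻ ξ, (∑' x : Fin k ↪ ξ.points,
      {x : Fin k → S | ∀ i, x i ∈ B}.indicator (1 : (Fin k → S) → ℝ≥0∞)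
        (fun i => (x i : S))) ∂P := by
    refine lintegral_congr_ae ?_
    filter_upwards [hP.simple, hN] with ξ hξ hξN
    obtain ⟨F, hF, hc⟩ := ξ.exists_finset_points hξ hB
      ((measure_mono subset_closure).trans_lt (ξ.2.1 _ hBc))
    rw [ξ.tsum_embedding_indicator hF]
    rw [hξN] at hc
    rw [Nat.cast_injective hc]
  rw [h2, h1, ← Measure.restrict_pi_pi, ← hpi, ← lintegral_indicator hms]
  refine lintegral_congr fun x => ?_
  by_cases hx : x ∈ {x : Fin k → S | ∀ i, x i ∈ B} <;> simp [Set.indicator, hx]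

theorem IsDeterminantal.lintegral_count (hP : IsDeterminantal P lam K) {B : Set S}
    (hB : MeasurableSet B) (hBc : IsCompact (closure B)) {N : Conf S → ℕ}
    (hN : ∀ᵐ ξ ∂P, ξ.1 B = N ξ) :
    ∫⁻ ξ, N ξ ∂P = ∫⁻ x in B, ENNReal.ofReal (K x x).re ∂lam := by
  have h1 := hP.lintegral_descFactorial hB hBc hN 1
  have h2 := (measurePreserving_funUnique (lam.restrict B) (Fin 1)).lintegral_comp_emb
    (MeasurableEquiv.measurableEmbedding _) fun x => ENNReal.ofReal (K x x).re
  rw [← h2]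
  simp only [Nat.descFactorial_one, Matrix.det_unique, Matrix.of_apply] at h1
  convert h1 using 4
  rfl

theorem IsDeterminantal.lintegral_count_mul (hP : IsDeterminantal P lam K) {B : Set S}
    (hB : MeasurableSet B) (hBc : IsCompact (closure B)) {N : Conf S → ℕ}
    (hN : ∀ᵐ ξ ∂P, ξ.1 B = N ξ) :
    ∫⁻ ξ, ((N ξ).descFactorial 2 : ℕ) ∂P
      = ∫⁻ z, ENNReal.ofReal (K z.1 z.1 * K z.2 z.2 - K z.1 z.2 * K z.2 z.1).re
          ∂(lam.restrict B).prod (lam.restrict B) := by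
  have h1 := hP.lintegral_descFactorial hB hBc hN 2
  have h2 := (measurePreserving_finTwoArrow (lam.restrict B)).lintegral_comp_emb
    (MeasurableEquiv.measurableEmbedding _)
    fun z => ENNReal.ofReal (K z.1 z.1 * K z.2 z.2 - K z.1 z.2 * K z.2 z.1).re
  rw [← h2, h1]
  simp [Matrix.det_fin_two]

/-- The first two factorial moments, in terms of mean and variance. -/
theorem IsDeterminantal.ofReal_integral_countIn [IsProbabilityMeasure P]
    (hP : IsDeterminantal P lam K) {B : Set S}
    (hB : MeasurableSet B) (hBc : IsCompact (closure B)) (hL2 : MemLp (countIn B) 2 P) :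
    ENNReal.ofReal (∫ ξ, countIn B ξ ∂P) = ∫⁻ x in B, ENNReal.ofReal (K x x).re ∂lam ∧
    ENNReal.ofReal (variance (countIn B) P + (∫ ξ, countIn B ξ ∂P) ^ 2 - ∫ ξ, countIn B ξ ∂P)
      = ∫⁻ z, ENNReal.ofReal (K z.1 z.1 * K z.2 z.2 - K z.1 z.2 * K z.2 z.1).re
          ∂(lam.restrict B).prod (lam.restrict B) ∧
    0 ≤ variance (countIn B) P + (∫ ξ, countIn B ξ ∂P) ^ 2 - ∫ ξ, countIn B ξ ∂P := by
  have hex : ∀ ξ : Conf S, ∃ k : ℕ, ξ.1 B = k := fun ξ =>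
    (ξ.2.2 B hB).resolve_left ((measure_mono subset_closure).trans_lt (ξ.2.1 _ hBc)).ne
  choose N hN using hex
  have hcount : countIn B = fun ξ => (N ξ : ℝ) := by
    funext ξ
    rw [countIn, hN, ENNReal.toReal_natCast]
  have hN' : ∀ᵐ ξ ∂P, ξ.1 B = N ξ := Eventually.of_forall hN
  have hI1 : Integrable (fun ξ => (N ξ : ℝ)) P := hcount ▸ hL2.integrable one_le_two
  have hI2 : Integrable (fun ξ => (N ξ : ℝ) ^ 2) P := by
    have := hL2.integrable_sq
    rwa [hcount] at this
  have hd : ∀ n : ℕ, ((n.descFactorial 2 : ℕ) : ℝ) = (n : ℝ) ^ 2 - n := fun n => by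
    rcases n with _ | n
    · simp
    · simp [Nat.descFactorial]; ring
  have hfac : variance (countIn B) P + (∫ ξ, countIn B ξ ∂P) ^ 2 - ∫ ξ, countIn B ξ ∂P
      = ∫ ξ, (((N ξ).descFactorial 2 : ℕ) : ℝ) ∂P := by
    rw [variance_eq_sub hL2, sub_add_cancel, hcount]
    simp only [Pi.pow_apply, hd]
    rw [← integral_sub hI2 hI1]
  refine ⟨?_, ?_, ?_⟩
  · rw [← hP.lintegral_count hB hBc hN', hcount,
      ofReal_integral_eq_lintegral_ofReal hI1 (Eventually.of_forall fun ξ => Nat.cast_nonneg _)]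
    simp
  · rw [← hP.lintegral_count_mul hB hBc hN', hfac, ofReal_integral_eq_lintegral_ofReal
      ((hI2.sub hI1).congr (Eventually.of_forall fun ξ => (hd _).symm))
      (Eventually.of_forall fun ξ => Nat.cast_nonneg _)]
    simp only [ENNReal.ofReal_natCast]
  · rw [hfac]
    exact integral_nonneg fun ξ => Nat.cast_nonneg _

end PointProcess

/-! ### The diagonal of the correlation kernel -/

section Averages

/-- A vector-valued function whose averages are dominated by those of `g` is dominated by `g`:
test against a countable dense set of directions. -/
theorem ae_norm_le_of_forall_norm_setIntegral_le {α E : Type*} [MeasurableSpace α]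
    [NormedAddCommGroup E] [InnerProductSpace ℂ E] [CompleteSpace E]
    [TopologicalSpace.SeparableSpace E] {ν : Measure α} {v : α → E} {g : α → ℝ}
    (hv : Integrable v ν) (hg : Integrable g ν)
    (h : ∀ B, MeasurableSet B → ‖∫ x in B, v x ∂ν‖ ≤ ∫ x in B, g x ∂ν) :
    ∀ᵐ x ∂ν, ‖v x‖ ≤ g x := by
  have hg0 : 0 ≤ᵐ[ν] g := ae_nonneg_of_forall_setIntegral_nonneg hg fun B hB _ =>
    (norm_nonneg _).trans (h B hB)
  have hc : ∀ c : E, ∀ᵐ x ∂ν, (inner ℂ c (v x)).re ≤ ‖c‖ * g x := by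
    intro c
    refine ae_le_of_forall_setIntegral_le (Complex.reCLM.integrable_comp (hv.const_inner c))
      (hg.const_mul _) fun B hB _ => ?_
    have h1 : ∫ x in B, (inner ℂ c (v x)).re ∂ν = (inner ℂ c (∫ x in B, v x ∂ν)).re := by
      rw [← integral_inner hv.integrableOn]
      exact integral_re (𝕜 := ℂ) (hv.const_inner c).integrableOn
    change ∫ x in B, (inner ℂ c (v x)).re ∂ν ≤ _
    rw [h1, integral_const_mul]
    exact (re_inner_le_norm (𝕜 := ℂ) _ _).trans
      (mul_le_mul_of_nonneg_left (h B hB) (norm_nonneg _))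
  have hall : ∀ᵐ x ∂ν, ∀ n, (inner ℂ (TopologicalSpace.denseSeq E n) (v x)).re
      ≤ ‖TopologicalSpace.denseSeq E n‖ * g x := ae_all_iff.2 fun n => hc _
  filter_upwards [hall, hg0] with x hx hx0
  have h2 : ∀ c : E, (inner ℂ c (v x)).re ≤ ‖c‖ * g x := fun c =>
    (TopologicalSpace.denseRange_denseSeq E).induction_on c
      (isClosed_le (Complex.continuous_re.comp (by fun_prop)) (by fun_prop)) hx
  have h3 := h2 (v x)
  have h4 : (inner ℂ (v x) (v x)).re = ‖v x‖ ^ 2 := (norm_sq_eq_re_inner (𝕜 := ℂ) (v x)).symm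
  rw [h4] at h3
  rcases (norm_nonneg (v x)).eq_or_lt with h0 | h0
  · rw [← h0]; exact hx0
  · nlinarith

end Averages

section Determinantal

variable {S : Type*} [MetricSpace S] [MeasurableSpace S] {lam : Measure S}
  {𝒦 : Lp ℂ 2 lam →L[ℂ] Lp ℂ 2 lam} {Λ : Set S} {hΛ : MeasurableSet Λ}
  {μ : ℕ → ℝ} {Φ : ℕ → Lp ℂ 2 lam} {K : S → S → ℂ} {P : Measure (Conf S)}

theorem IsDeterminantal.ae_diag_eq_re (hP : IsDeterminantal P lam K) :
    ∀ᵐ x ∂lam, 0 ≤ (K x x).re ∧ K x x = ((K x x).re : ℂ) := by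
  filter_upwards [hP.ae_diag_nonneg] with x hx
  exact ⟨(Complex.le_def.1 hx).1, Complex.ext rfl (Complex.le_def.1 hx).2.symm⟩

variable [SigmaFinite lam]

theorem IsDeterminantal.ae_det_two_re [TopologicalSpace.SeparableSpace (Lp ℂ 2 lam)]
    (hP : IsDeterminantal P lam K) (hK : IsKernelOf K 𝒦)
    (h : IsSpectralDecomposition (opM 𝒦 hΛ) μ Φ) (hs : Summable μ) :
    ∀ᵐ z ∂(lam.restrict Λ).prod (lam.restrict Λ),
      (K z.1 z.1 * K z.2 z.2 - K z.1 z.2 * K z.2 z.1).re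
        = (K z.1 z.1).re * (K z.2 z.2).re - ‖K z.1 z.2‖ ^ 2 ∧
      ‖K z.1 z.2‖ ^ 2 ≤ (K z.1 z.1).re * (K z.2 z.2).re := by
  have hd := ae_restrict_of_ae (s := Λ) hP.ae_diag_eq_re
  have h2 : ∀ᵐ z ∂(lam.restrict Λ).prod (lam.restrict Λ),
      0 ≤ K z.1 z.1 * K z.2 z.2 - K z.1 z.2 * K z.2 z.1 := by
    rw [Measure.prod_restrict]
    exact ae_restrict_of_ae hP.ae_det_two_nonneg
  filter_upwards [ae_kernel_hermitian hK h hs, h2, Measure.quasiMeasurePreserving_fst.ae hd,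
    Measure.quasiMeasurePreserving_snd.ae hd] with z h1 h2 h3 h4
  have h5 : (K z.1 z.1 * K z.2 z.2 - K z.1 z.2 * K z.2 z.1).re
      = (K z.1 z.1).re * (K z.2 z.2).re - ‖K z.1 z.2‖ ^ 2 := by
    rw [h1, Complex.mul_conj, Complex.normSq_eq_norm_sq, Complex.sub_re, Complex.ofReal_re,
      h3.2, h4.2, ← Complex.ofReal_mul, Complex.ofReal_re, Complex.ofReal_re, Complex.ofReal_re]
  have h6 := (Complex.le_def.1 h2).1
  rw [h5, Complex.zero_re] at h6
  exact ⟨h5, by linarith⟩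

/-- The variance is at least `E ξ(Λ) - Tr M_Λ²`. -/
theorem IsDeterminantal.integral_countIn_sub_le_variance [SecondCountableTopology S] [BorelSpace S]
    [TopologicalSpace.SeparableSpace (Lp ℂ 2 lam)] [IsProbabilityMeasure P]
    (hP : IsDeterminantal P lam K) (hK : IsKernelOf K 𝒦)
    (h : IsSpectralDecomposition (opM 𝒦 hΛ) μ Φ) (hs : Summable μ) (hs2 : Summable fun j => μ j ^ 2)
    (hΛc : IsCompact (closure Λ)) (hL2 : MemLp (countIn Λ) 2 P) :
    ∫ ξ, countIn Λ ξ ∂P - ∑' j, μ j ^ 2 ≤ variance (countIn Λ) P := by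
  obtain ⟨h1, h2, h3⟩ := hP.ofReal_integral_countIn hΛ hΛc hL2
  set m := ∫ ξ, countIn Λ ξ ∂P
  set V := variance (countIn Λ) P
  have hdm : Measurable fun x => ENNReal.ofReal (K x x).re :=
    (Complex.measurable_re.comp (hK.measurable.comp
      (measurable_id.prodMk measurable_id))).ennreal_ofReal
  have hKm : Measurable fun z : S × S => ‖K z.1 z.2‖ₑ ^ 2 := (hK.measurable.enorm).pow_const 2
  have h0 : 0 ≤ m := integral_nonneg fun ξ => ENNReal.toReal_nonneg
  have h4 : ENNReal.ofReal m * ENNReal.ofReal m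
      ≤ ENNReal.ofReal (V + m ^ 2 - m) + ENNReal.ofReal (∑' j, μ j ^ 2) := by
    calc _ = ∫⁻ z, ENNReal.ofReal (K z.1 z.1).re * ENNReal.ofReal (K z.2 z.2).re
            ∂(lam.restrict Λ).prod (lam.restrict Λ) := by
          rw [h1, lintegral_prod_mul hdm.aemeasurable hdm.aemeasurable]
      _ = ∫⁻ z, (ENNReal.ofReal (K z.1 z.1 * K z.2 z.2 - K z.1 z.2 * K z.2 z.1).re
            + ‖K z.1 z.2‖ₑ ^ 2) ∂(lam.restrict Λ).prod (lam.restrict Λ) := by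
          have hd := ae_restrict_of_ae (s := Λ) hP.ae_diag_eq_re
          refine lintegral_congr_ae ?_
          filter_upwards [hP.ae_det_two_re hK h hs, Measure.quasiMeasurePreserving_fst.ae hd]
            with z hz hz1
          rw [hz.1, ← ofReal_norm, ← ENNReal.ofReal_pow (norm_nonneg _),
            ← ENNReal.ofReal_add (sub_nonneg.2 hz.2) (sq_nonneg _), sub_add_cancel,
            ENNReal.ofReal_mul hz1.1]
      _ = ENNReal.ofReal (V + m ^ 2 - m)
            + ∫⁻ x in Λ, ∫⁻ y in Λ, ‖K x y‖ₑ ^ 2 ∂lam ∂lam := by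
          rw [lintegral_add_right _ hKm, ← h2, lintegral_prod _ hKm.aemeasurable]
      _ ≤ _ := by
          gcongr
          exact lintegral_lintegral_enorm_sq_kernel_le hK h hs2
  have h5 : 0 ≤ ∑' j, μ j ^ 2 := tsum_nonneg fun j => sq_nonneg _
  rw [← ENNReal.ofReal_mul h0, ← ENNReal.ofReal_add h3 h5,
    ENNReal.ofReal_le_ofReal_iff (by positivity)] at h4
  linarith

variable [TopologicalSpace.SeparableSpace (Lp ℂ 2 lam)]

/-- Testing `M_Λ` on indicator functions, with `|K(x, y)|² ≤ K(x, x) K(y, y)`. -/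
theorem IsDeterminantal.sum_norm_sq_setIntegral_le (hP : IsDeterminantal P lam K)
    (hK : IsKernelOf K 𝒦) (h : IsSpectralDecomposition (opM 𝒦 hΛ) μ Φ) (hs : Summable μ)
    (hfin : lam Λ < ∞) (hint : IntegrableOn (fun x => Real.sqrt (K x x).re) Λ lam)
    {B : Set S} (hB : MeasurableSet B) (hBΛ : B ⊆ Λ) (J : Finset ℕ) :
    ∑ j ∈ J, μ j * ‖∫ x in B, Φ j x ∂lam‖ ^ 2 ≤ (∫ x in B, Real.sqrt (K x x).re ∂lam) ^ 2 := by
  have hBfin : lam B ≠ ∞ := ((measure_mono hBΛ).trans_lt hfin).ne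
  set f : Lp ℂ 2 lam := indicatorConstLp 2 hB hBfin 1
  set I := ∫ x in B, Real.sqrt (K x x).re ∂lam
  have hres : lam.restrict B ≤ lam.restrict Λ := Measure.restrict_mono_set lam hBΛ
  have h1 : ∑ j ∈ J, μ j * ‖∫ x in B, Φ j x ∂lam‖ ^ 2 ≤ (inner ℂ f (opM 𝒦 hΛ f)).re := by
    have h2 := sum_le_hasSum J (fun j _ => mul_nonneg (h.nonneg j) (sq_nonneg _))
      (h.hasSum_inner f)
    refine le_trans (le_of_eq (Finset.sum_congr rfl fun j _ => ?_)) h2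
    rw [norm_inner_symm, L2.inner_indicatorConstLp_one]
  have hpair : ∀ᵐ x ∂lam.restrict B, ∀ᵐ y ∂lam.restrict B,
      ‖K x y‖ ≤ Real.sqrt (K x x).re * Real.sqrt (K y y).re := by
    have h3 := Measure.ae_ae_of_ae_prod (hP.ae_det_two_re hK h hs)
    filter_upwards [ae_mono hres h3, ae_restrict_of_ae hP.ae_diag_eq_re] with x hx hx0
    filter_upwards [ae_mono hres hx] with y hy
    rw [← Real.sqrt_mul hx0.1]
    exact Real.le_sqrt_of_sq_le hy.2
  have hintB : IntegrableOn (fun x => Real.sqrt (K x x).re) B lam := hint.mono_set hBΛ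
  have h4 : ∀ᵐ x ∂lam.restrict B, ‖opM 𝒦 hΛ f x‖ ≤ Real.sqrt (K x x).re * I := by
    filter_upwards [ae_mono hres (opM_apply_ae hΛ hK f), hpair] with x hx hxy
    have h5 : ∫ y in Λ, K x y * f y ∂lam = ∫ y in B, K x y ∂lam := by
      rw [← integral_indicator hΛ, ← integral_indicator hB]
      refine integral_congr_ae ?_
      filter_upwards [indicatorConstLp_coeFn (p := 2) (hs := hB) (hμs := hBfin) (c := (1 : ℂ))]
        with y hy
      by_cases hyB : y ∈ B
      · simp [f, hy, hyB, hBΛ hyB]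
      · by_cases hyΛ : y ∈ Λ <;> simp [f, hy, hyB, hyΛ]
    rw [hx, h5, ← integral_const_mul]
    exact norm_integral_le_of_norm_le (hintB.const_mul _) hxy
  have h6 : ‖inner ℂ f (opM 𝒦 hΛ f)‖ ≤ I * I := by
    rw [L2.inner_indicatorConstLp_one, ← integral_mul_const]
    exact norm_integral_le_of_norm_le (hintB.mul_const _) h4
  calc _ ≤ _ := h1
    _ ≤ ‖inner ℂ f (opM 𝒦 hΛ f)‖ := Complex.re_le_norm _
    _ ≤ I * I := h6
    _ = _ := (sq I).symm

/-- The diagonal of the correlation kernel dominates the diagonal of the Mercer expansion.  The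
operator determines `K` up to null sets of `S × S`, which says nothing about the diagonal; the
inequality is due to the positivity of the second correlation function. -/
theorem IsDeterminantal.ae_sum_eigenvalue_mul_norm_sq_le (hP : IsDeterminantal P lam K)
    (hK : IsKernelOf K 𝒦) (h : IsSpectralDecomposition (opM 𝒦 hΛ) μ Φ) (hs : Summable μ)
    (hfin : lam Λ < ∞) (hint : IntegrableOn (fun x => (K x x).re) Λ lam) (J : ℕ) :
    ∀ᵐ x ∂lam.restrict Λ, ∑ j ∈ Finset.range J, μ j * ‖Φ j x‖ ^ 2 ≤ (K x x).re := by
  have : IsFiniteMeasure (lam.restrict Λ) :=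
    ⟨by rwa [Measure.restrict_apply MeasurableSet.univ, Set.univ_inter]⟩
  have hd0 := ae_restrict_of_ae (s := Λ) hP.ae_diag_eq_re
  have hsqrt : IntegrableOn (fun x => Real.sqrt (K x x).re) Λ lam := by
    refine ((integrable_const (1 : ℝ)).add hint).mono'
      (Real.continuous_sqrt.comp_aestronglyMeasurable hint.1) ?_
    filter_upwards [hd0] with x hx
    rw [Real.norm_of_nonneg (Real.sqrt_nonneg _), Pi.add_apply]
    nlinarith [Real.sq_sqrt hx.1, sq_nonneg (Real.sqrt (K x x).re - 1)]
  -- the truncated feature map: `‖v x‖²` is the partial sum, and its averages are controlled by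
  -- the bound on indicator functions
  let v : S → EuclideanSpace ℂ (Fin J) := fun x =>
    WithLp.toLp 2 fun j => (Real.sqrt (μ j) : ℂ) * Φ j x
  have hΦ : ∀ j, Integrable (Φ j) (lam.restrict Λ) := fun j =>
    ((Lp.memLp (Φ j)).restrict Λ).integrable one_le_two
  have hv : Integrable v (lam.restrict Λ) :=
    Integrable.of_eval_piLp fun j => (hΦ j).const_mul _
  have hle := ae_norm_le_of_forall_norm_setIntegral_le hv hsqrt fun B hB => by
    have h1 := hP.sum_norm_sq_setIntegral_le hK h hs hfin hsqrt (hB.inter hΛ)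
      Set.inter_subset_right (Finset.range J)
    rw [Measure.restrict_restrict hB]
    refine (sq_le_sq₀ (norm_nonneg _) (integral_nonneg fun x => Real.sqrt_nonneg _)).1
      (le_trans (le_of_eq ?_) h1)
    rw [EuclideanSpace.norm_sq_eq, ← Fin.sum_univ_eq_sum_range
      (fun j => μ j * ‖∫ x in B ∩ Λ, Φ j x ∂lam‖ ^ 2)]
    refine Finset.sum_congr rfl fun j _ => ?_
    have he : (∫ x in B ∩ Λ, v x ∂lam) j = ∫ x in B ∩ Λ, v x j ∂lam :=
      eval_integral_piLp (fun i : Fin J => ((hΦ i).const_mul _).mono_measure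
        (Measure.restrict_mono_set lam Set.inter_subset_right)) j
    rw [he]
    simp only [v]
    rw [integral_const_mul, norm_mul, mul_pow, Complex.norm_real,
      Real.norm_of_nonneg (Real.sqrt_nonneg _), Real.sq_sqrt (h.nonneg j)]
  filter_upwards [hle, hd0] with x hx hx0
  have h2 := pow_le_pow_left₀ (norm_nonneg _) hx 2
  rw [Real.sq_sqrt hx0.1, EuclideanSpace.norm_sq_eq] at h2
  refine le_trans (le_of_eq ?_) h2
  rw [← Fin.sum_univ_eq_sum_range (fun j => μ j * ‖Φ j x‖ ^ 2)]
  refine Finset.sum_congr rfl fun j _ => ?_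
  simp only [v]
  rw [norm_mul, mul_pow, Complex.norm_real, Real.norm_of_nonneg (Real.sqrt_nonneg _),
    Real.sq_sqrt (h.nonneg j)]

end Determinantal

/-! ### Accumulated spectrograms -/

section Spectrograms

variable {S : Type*} [MeasurableSpace S] {lam : Measure S}
  {𝒦 : Lp ℂ 2 lam →L[ℂ] Lp ℂ 2 lam} {Λ : Set S} {hΛ : MeasurableSet Λ}
  {μ : ℕ → ℝ} {Φ : ℕ → Lp ℂ 2 lam}

theorem integrable_norm_sq_Lp (f : Lp ℂ 2 lam) : Integrable (fun x => ‖f x‖ ^ 2) lam :=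
  (memLp_two_iff_integrable_sq_norm (Lp.memLp f).1).1 (Lp.memLp f)

theorem integral_norm_sq_Lp (f : Lp ℂ 2 lam) : ∫ x, ‖f x‖ ^ 2 ∂lam = ‖f‖ ^ 2 := by
  rw [integral_eq_lintegral_of_nonneg_ae (Eventually.of_forall fun x => sq_nonneg _)
    (integrable_norm_sq_Lp f).1]
  have h1 : ∀ x, ENNReal.ofReal (‖f x‖ ^ 2) = ‖f x‖ₑ ^ 2 := fun x => by
    rw [ENNReal.ofReal_pow (norm_nonneg _), ofReal_norm]
  simp_rw [h1]
  rw [lintegral_enorm_sq_Lp, ENNReal.toReal_ofReal (sq_nonneg _)]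

theorem integrable_accumulatedSpectrogram (Φ : ℕ → Lp ℂ 2 lam) :
    Integrable (accumulatedSpectrogram 𝒦 hΛ Φ) lam :=
  integrable_finsetSum _ fun _ _ => integrable_norm_sq_Lp _

theorem integral_accumulatedSpectrogram_le (h𝒦 : IsStarProjection 𝒦)
    (h : IsSpectralDecomposition (opM 𝒦 hΛ) μ Φ) :
    ∫ x, accumulatedSpectrogram 𝒦 hΛ Φ x ∂lam ≤ ceilTrace 𝒦 hΛ := by
  unfold accumulatedSpectrogram
  rw [integral_finsetSum _ fun _ _ => integrable_norm_sq_Lp _]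
  calc _ ≤ ∑ j ∈ Finset.range (ceilTrace 𝒦 hΛ), (1 : ℝ) := by
        refine Finset.sum_le_sum fun j _ => ?_
        rw [integral_norm_sq_Lp]
        exact pow_le_one₀ (norm_nonneg _) (norm_polarFactor_le_one h𝒦 h j)
    _ = _ := by simp

theorem accumulatedSpectrogram_ae (h𝒦 : IsStarProjection 𝒦)
    (h : IsSpectralDecomposition (opM 𝒦 hΛ) μ Φ) :
    ∀ᵐ x ∂lam.restrict Λ, accumulatedSpectrogram 𝒦 hΛ Φ x
      = ∑ j ∈ Finset.range (ceilTrace 𝒦 hΛ), μ j * ‖Φ j x‖ ^ 2 := by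
  filter_upwards [ae_all_iff.2 (norm_sq_polarFactor_ae h𝒦 h)] with x hx
  exact Finset.sum_congr rfl fun j _ => hx j

theorem setIntegral_eigenvalue_mul_norm_sq (h𝒦 : IsStarProjection 𝒦)
    (h : IsSpectralDecomposition (opM 𝒦 hΛ) μ Φ) (j : ℕ) :
    ∫ x in Λ, μ j * ‖Φ j x‖ ^ 2 ∂lam = μ j := by
  rw [← integral_congr_ae (norm_sq_polarFactor_ae h𝒦 h j), ← integral_indicator hΛ]
  have h1 : ∫ x, Λ.indicator (fun x => ‖polarFactor (opN 𝒦 hΛ) (Φ j) x‖ ^ 2) x ∂lam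
      = ∫ x, ‖restrictOp lam hΛ (polarFactor (opN 𝒦 hΛ) (Φ j)) x‖ ^ 2 ∂lam := by
    refine integral_congr_ae ?_
    filter_upwards [restrictOp_coeFn hΛ (polarFactor (opN 𝒦 hΛ) (Φ j))] with x hx
    rw [hx]
    by_cases hx' : x ∈ Λ <;> simp [hx']
  rw [h1, integral_norm_sq_Lp, restrictOp_polarFactor h𝒦 h, norm_smul, h.orthonormal.1, mul_one,
    Complex.norm_real, Real.norm_of_nonneg (Real.sqrt_nonneg _), Real.sq_sqrt (h.nonneg j)]

theorem setIntegral_sum_eigenvalue_mul_norm_sq (h𝒦 : IsStarProjection 𝒦)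
    (h : IsSpectralDecomposition (opM 𝒦 hΛ) μ Φ) (J : ℕ) :
    ∫ x in Λ, ∑ j ∈ Finset.range J, μ j * ‖Φ j x‖ ^ 2 ∂lam = ∑ j ∈ Finset.range J, μ j := by
  rw [integral_finsetSum _ fun j _ => ((integrable_norm_sq_Lp (Φ j)).restrict).const_mul _]
  exact Finset.sum_congr rfl fun j _ => setIntegral_eigenvalue_mul_norm_sq h𝒦 h j

end Spectrograms

section SpectrogramBound

variable {S : Type*} [MetricSpace S] [SecondCountableTopology S] [MeasurableSpace S] [BorelSpace S]
  {lam : Measure S} [SigmaFinite lam] {𝒦 : Lp ℂ 2 lam →L[ℂ] Lp ℂ 2 lam}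
  {Λ : Set S} {hΛ : MeasurableSet Λ} {μ : ℕ → ℝ} {Φ : ℕ → Lp ℂ 2 lam} {K : S → S → ℂ}
  {P : Measure (Conf S)} [IsProbabilityMeasure P]

theorem IsDeterminantal.integrableOn_diag (hP : IsDeterminantal P lam K)
    (hKm : Measurable (Function.uncurry K)) (hΛ : MeasurableSet Λ) (hΛc : IsCompact (closure Λ))
    (hL2 : MemLp (countIn Λ) 2 P) :
    IntegrableOn (fun x => K x x) Λ lam ∧ IntegrableOn (fun x => (K x x).re) Λ lam ∧
      ∫ x in Λ, (K x x).re ∂lam = ∫ ξ, countIn Λ ξ ∂P := by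
  have hm : Measurable fun x => K x x := hKm.comp (measurable_id.prodMk measurable_id)
  have hd := ae_restrict_of_ae (s := Λ) hP.ae_diag_eq_re
  have hd0 : 0 ≤ᵐ[lam.restrict Λ] fun x => (K x x).re := hd.mono fun x hx => hx.1
  obtain ⟨h1, -⟩ := hP.ofReal_integral_countIn hΛ hΛc hL2
  have hre : IntegrableOn (fun x => (K x x).re) Λ lam :=
    (lintegral_ofReal_ne_top_iff_integrable
      (Complex.measurable_re.comp hm).aestronglyMeasurable hd0).1
      (h1 ▸ ENNReal.ofReal_ne_top)
  refine ⟨hre.ofReal.congr (hd.mono fun x hx => hx.2.symm), hre, ?_⟩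
  rw [integral_eq_lintegral_of_nonneg_ae hd0 hre.1, ← h1,
    ENNReal.toReal_ofReal (integral_nonneg (f := countIn Λ) fun ξ => ENNReal.toReal_nonneg)]

/-- The quantitative form of the theorem: at each scale, the `L¹`-distance is at most
`1 + 2 var ξ(Λ)`, and `⌈Tr M_Λ⌉ ≥ E ξ(Λ) - var ξ(Λ)`. -/
theorem IsDeterminantal.integral_norm_accumulatedSpectrogram_sub_le (h𝒦 : IsStarProjection 𝒦)
    (hP : IsDeterminantal P lam K) (hK : IsKernelOf K 𝒦) (htr : IsTraceClass (opM 𝒦 hΛ))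
    (h : IsSpectralDecomposition (opM 𝒦 hΛ) μ Φ) (hfin : lam Λ < ∞) (hΛc : IsCompact (closure Λ))
    (hL2 : MemLp (countIn Λ) 2 P) :
    ∫ x, ‖(accumulatedSpectrogram 𝒦 hΛ Φ x : ℂ) - Λ.indicator (fun x => K x x) x‖ ∂lam
      ≤ 1 + 2 * variance (countIn Λ) P ∧
    ∫ ξ, countIn Λ ξ ∂P - variance (countIn Λ) P ≤ ceilTrace 𝒦 hΛ := by
  -- the instance that makes `L²` separable
  have : Fact ((2 : ℝ≥0∞) ≠ ∞) := ⟨ENNReal.ofNat_ne_top⟩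
  have hs : Summable μ := h.summable_of_isTraceClass (opM_isPositive h𝒦 hΛ) htr
  have h1 := eigenvalue_le_one h𝒦 h
  have hs2 : Summable fun j => μ j ^ 2 := hs.of_nonneg_of_le (fun j => sq_nonneg _)
    fun j => by nlinarith [h.nonneg j, h1 j]
  have hvar := hP.integral_countIn_sub_le_variance hK h hs hs2 hΛc hL2
  obtain ⟨-, hint, hmean⟩ := hP.integrableOn_diag hK.measurable hΛ hΛc hL2
  set N := ceilTrace 𝒦 hΛ with hNdef
  set m := ∫ ξ, countIn Λ ξ ∂P
  set V := variance (countIn Λ) P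
  set ρ := accumulatedSpectrogram 𝒦 hΛ Φ
  have ht0 : 0 ≤ ∑' j, μ j := tsum_nonneg h.nonneg
  have hN : N = ⌈∑' j, μ j⌉₊ := by
    rw [hNdef, ceilTrace, h.re_opTrace (opM_isPositive h𝒦 hΛ)]
  have hN1 : ∑' j, μ j ≤ N := hN ▸ Nat.le_ceil _
  have hN2 : (N : ℝ) < ∑' j, μ j + 1 := hN ▸ Nat.ceil_lt_add_one ht0
  have hsq : ∑' j, μ j ^ 2 ≤ ∑' j, μ j :=
    hs2.tsum_le_tsum (fun j => by nlinarith [h.nonneg j, h1 j]) hs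
  have hdiag := hP.ae_sum_eigenvalue_mul_norm_sq_le hK h hs hfin hint
  have htm : ∑' j, μ j ≤ m := by
    refine hs.tsum_le_of_sum_range_le fun J => ?_
    rw [← hmean, ← setIntegral_sum_eigenvalue_mul_norm_sq h𝒦 h]
    exact integral_mono_ae (integrable_finsetSum _ fun j _ =>
      ((integrable_norm_sq_Lp (Φ j)).restrict).const_mul _) hint (hdiag J)
  have htail := tsum_tail_le_tsum_sub_tsum_sq h.antitone h.nonneg h1 hs hN1
  have hsplit := hs.sum_add_tsum_nat_add N
  have hρ : Integrable ρ lam := integrable_accumulatedSpectrogram Φ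
  have hρΛ : ∫ x in Λ, ρ x ∂lam = ∑ j ∈ Finset.range N, μ j := by
    rw [integral_congr_ae (accumulatedSpectrogram_ae h𝒦 h)]
    exact setIntegral_sum_eigenvalue_mul_norm_sq h𝒦 h N
  have hρN : ∫ x, ρ x ∂lam ≤ N := integral_accumulatedSpectrogram_le h𝒦 h
  have hρ0 : ∀ x, 0 ≤ ρ x := fun x => Finset.sum_nonneg fun j _ => sq_nonneg _
  refine ⟨?_, by linarith⟩
  -- on `Λ` the spectrogram is at most `K x x`, and off `Λ` there is only the spectrogram
  have hpt : ∀ᵐ x ∂lam, ‖(ρ x : ℂ) - Λ.indicator (fun x => K x x) x‖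
      = ρ x - 2 * Λ.indicator ρ x + Λ.indicator (fun x => (K x x).re) x := by
    filter_upwards [(ae_restrict_iff' hΛ).1 (hdiag N),
      (ae_restrict_iff' hΛ).1 (accumulatedSpectrogram_ae h𝒦 h), hP.ae_diag_eq_re] with x
      hx1 hx2 hx3
    by_cases hx : x ∈ Λ
    · have hle : ρ x ≤ (K x x).re := by
        change accumulatedSpectrogram 𝒦 hΛ Φ x ≤ _
        rw [hx2 hx]; exact hx1 hx
      rw [Set.indicator_of_mem hx, Set.indicator_of_mem hx, Set.indicator_of_mem hx, hx3.2,
        ← Complex.ofReal_sub, Complex.norm_real, Complex.ofReal_re,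
        Real.norm_of_nonpos (by linarith)]
      ring
    · rw [Set.indicator_of_notMem hx, Set.indicator_of_notMem hx, Set.indicator_of_notMem hx,
        sub_zero, Complex.norm_real, Real.norm_of_nonneg (hρ0 x)]
      ring
  have hsub : Integrable (fun x => ρ x - 2 * Λ.indicator ρ x) lam :=
    hρ.sub ((hρ.indicator hΛ).const_mul 2)
  rw [integral_congr_ae hpt, integral_add hsub
    ((integrable_indicator_iff hΛ).2 hint), integral_sub hρ ((hρ.indicator hΛ).const_mul 2),
    integral_const_mul, integral_indicator hΛ, integral_indicator hΛ, hρΛ, hmean]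
  linarith

end SpectrogramBound

/-! ### The limit along the exhaustion -/

theorem tendsto_of_le_one_add_two_mul_variance {m V N I : ℕ → ℝ} (hm : Tendsto m atTop atTop)
    (hV : Tendsto (fun n => V n / m n) atTop (𝓝 0)) (hN : ∀ n, m n - V n ≤ N n)
    (hI0 : ∀ n, 0 ≤ I n) (hI : ∀ n, I n ≤ 1 + 2 * V n) :
    Tendsto (fun n => 1 / N n * I n) atTop (𝓝 0) := by
  have hb : Tendsto (fun n => (1 / m n + 2 * (V n / m n)) / (1 - V n / m n)) atTop (𝓝 0) := by
    have h1 : Tendsto (fun n => 1 / m n) atTop (𝓝 0) := by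
      simp only [one_div]
      exact hm.inv_tendsto_atTop
    have h2 := (h1.add (hV.const_mul 2)).div (hV.const_sub 1) (by norm_num)
    simp only [mul_zero, add_zero, sub_zero, zero_div] at h2
    exact h2
  have hpos : ∀ᶠ n in atTop, 0 < m n ∧ V n / m n < 1 :=
    (hm.eventually_gt_atTop 0).and (hV.eventually_lt_const one_pos)
  refine tendsto_of_tendsto_of_tendsto_of_le_of_le' tendsto_const_nhds hb ?_ ?_
  · filter_upwards [hpos] with n hn
    have hlt : V n < m n := (div_lt_one hn.1).1 hn.2
    have hNn : 0 ≤ N n := by linarith [hN n]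
    exact mul_nonneg (one_div_nonneg.2 hNn) (hI0 n)
  · filter_upwards [hpos] with n hn
    have hlt : V n < m n := (div_lt_one hn.1).1 hn.2
    have e : (1 / m n + 2 * (V n / m n)) / (1 - V n / m n) = (1 + 2 * V n) / (m n - V n) := by
      have h1 := hn.1.ne'
      have h2 : m n - V n ≠ 0 := (sub_pos.2 hlt).ne'
      have h3 : 1 - V n / m n = (m n - V n) / m n := by field_simp
      rw [h3]
      field_simp
    rw [e, one_div_mul_eq_div]
    exact div_le_div₀ ((hI0 n).trans (hI n)) (hI n) (sub_pos.2 hlt) (hN n)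

theorem theorem1p1 {S : Type*} [MetricSpace S] [CompleteSpace S]
    [TopologicalSpace.SeparableSpace S] [LocallyCompactSpace S]
    [MeasurableSpace S] [BorelSpace S]
    (lam : Measure S) [IsLocallyFiniteMeasure lam]
    (𝒦 : Lp ℂ 2 lam →L[ℂ] Lp ℂ 2 lam) (h𝒦 : IsStarProjection 𝒦)
    (h𝒦tr : IsLocallyTraceClass 𝒦)
    (K : S → S → ℂ) (hK : IsKernelOf K 𝒦)
    (P : Measure (Conf S)) [IsProbabilityMeasure P] (hP : IsDeterminantal P lam K)
    (Λ : ℕ → Set S) (hΛ : IsExhaustion Λ) (hhyp : IsHyperuniform P Λ)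
    (μ : ℕ → ℕ → ℝ) (Φ : ℕ → ℕ → Lp ℂ 2 lam)
    (hspec : ∀ n, IsSpectralDecomposition (opM 𝒦 (hΛ.measurableSet n)) (μ n) (Φ n)) :
    (∀ n, Integrable (accumulatedSpectrogram 𝒦 (hΛ.measurableSet n) (Φ n)) lam) ∧
    (∀ n, Integrable ((Λ n).indicator fun x => K x x) lam) ∧
    Tendsto (fun n => 1 / (ceilTrace 𝒦 (hΛ.measurableSet n) : ℝ) *
        ∫ x, ‖(accumulatedSpectrogram 𝒦 (hΛ.measurableSet n) (Φ n) x : ℂ)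
          - (Λ n).indicator (fun x => K x x) x‖ ∂lam)
      atTop (𝓝 0) := by
  have : SecondCountableTopology S := UniformSpace.secondCountable_of_separable S
  have hL2 : ∀ n, MemLp (countIn (Λ n)) 2 P := fun n =>
    hhyp.memLp _ (hΛ.measurableSet n) (hΛ.isCompact_closure n)
  have hbound := fun n => hP.integral_norm_accumulatedSpectrogram_sub_le h𝒦 hK
    (h𝒦tr _ (hΛ.measurableSet n) (hΛ.isCompact_closure n)) (hspec n)
    ((measure_mono subset_closure).trans_lt (hΛ.isCompact_closure n).measure_lt_top)
    (hΛ.isCompact_closure n) (hL2 n)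
  refine ⟨fun n => integrable_accumulatedSpectrogram _, fun n => ?_, ?_⟩
  · exact (integrable_indicator_iff (hΛ.measurableSet n)).2 (hP.integrableOn_diag hK.measurable
      (hΛ.measurableSet n) (hΛ.isCompact_closure n) (hL2 n)).1
  · exact tendsto_of_le_one_add_two_mul_variance hhyp.tendsto_mean hhyp.tendsto_variance
      (fun n => (hbound n).2) (fun n => integral_nonneg fun x => norm_nonneg _)
      fun n => (hbound n).1
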